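/- For $x,y\in\{0,1\}^d$ let $\mathrm{ham}(x,y)$ be the Hamming distance. For points $p_1,\dots,p_n\in\{0,1\}^d$ and $1\le\ell<n$, the cost of centers $c_1,\dots,c_\ell\in\{0,1\}^d$ is $\max_{v\in[n]}\min_{u\in[\ell]}\mathrm{ham}(p_v,c_u)$, and $\mathrm{OPT}_{\mathrm{cen}}$ is the minimum cost over all choices of $\ell$ centers in $\{0,1\}^d$. The diameter of a partition of $[n]$ into clusters $P_1,\dots,P_\ell$ is $\max_{i}\max_{v,u\in P_i}\mathrm{ham}(p_v,p_u)$, and $\mathrm{OPT}_{\mathrm{diam}}$ is the minimum diameter over all partitions into $\ell$ clusters. Procedure $\mathrm{DIMREDHAMCENTER}(\ell,P,\delta)$, with a constant $c\in\mathbb N$. Put $k=\lceil c\,\lceil\log_2 n\rceil/\delta^2\rceil$ (so $k=O(\log n/\delta^2)$ for fixed $c$), draw a uniformly random matrix $R\in\{-1,1\}^{k\times d}$, let $f(x)=Rx^{\top}$ and $W_{ij}=\|f(p_i)-f(p_j)\|_2^2$. Start with $T=\{p_1\}$ and, until $T$ has $\ell$ elements, add to $T$ a point $p_m\in P\setminus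 T$ that maximizes $\min_{p_q\in T}W_{qm}$ (ties are broken arbitrarily; points are distinguished by their indices). Return $T$. Modified procedure. In addition, put every point into the cluster of a center in $T$ that is closest to it with respect to $W$ (ties are broken arbitrarily, except that every center belongs to its own cluster), and return the resulting partition into $\ell$ clusters. **Theorem.** For every constant $\alpha\ge 1$ there is $c_0$ such that for every constant $c\ge c_0$ the following holds for all $n,d,\ell$ with $1\le\ell<n$, all points $p_1,\dots,p_n\in\{0,1\}^d$ and all $\varepsilon\in(0,1/2)$. 1. $\mathrm{DIMREDHAMCENTER}(\ell,P,\varepsilon/5)$ can be implemented on a unit-cost random access machine (with integer arithmetic, arrays, fair coins, and ring operations and comparisons of real numbers) in time at most $C\,n\log n\,(d+\ell)/\varepsilon^2$ for all outcomes of the coins. With probability at least $1-n^{-\alpha}$, every set $T$ of $\ell$ centers that it can return (for any tie-breaking) has cost at most $(2+\varepsilon)\,\mathrm{OPT}_{\mathrm{cen}}$. 2. The modified procedure with $\delta=\varepsilon/5$ can be implemented within the same time bound, and with probability at least $1-n^{-\alpha}$ every partition that it can return has diameter at most $(2+\varepsilon)\,\mathrm{OPT}_{\mathrm{diam}}$.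 Here the programs and the constant $C$ depend only on $\alpha$ and $c$. -/

import Mathlib

open Finset MeasureTheory

/-! ### The two clustering problems in the Hamming cube -/

/-- `max_v min_u ham(p_v, c_u)`: the cost of the (at most `ℓ` distinct) centers `c` for the
points `p`. Used for `n, ℓ ≥ 1`, where the supremum and the infimum are a maximum and a minimum. -/
noncomputable def centerCost {n d ℓ : ℕ} (p : Fin n → Fin d → Bool) (c : Fin ℓ → Fin d → Bool) :
    ℕ :=
  ⨆ v : Fin n, ⨅ u : Fin ℓ, hammingDist (p v) (c u)

/-- The optimum of `ℓ`-center clustering of `p` in the Hamming space `{0,1}^d`. -/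
noncomputable def optCenterCost {n d : ℕ} (p : Fin n → Fin d → Bool) (ℓ : ℕ) : ℕ :=
  ⨅ c : Fin ℓ → Fin d → Bool, centerCost p c

/-- The maximum Hamming diameter of the clusters `{v | a v = i}`, `i < ℓ`
(an empty cluster has diameter `0`). -/
noncomputable def clusterDiam {n d ℓ : ℕ} (p : Fin n → Fin d → Bool) (a : Fin n → Fin ℓ) : ℕ :=
  ⨆ i : Fin ℓ, ⨆ v : {v : Fin n // a v = i}, ⨆ u : {u : Fin n // a u = i},
    hammingDist (p v) (p u)

/-- The optimum of minimum-diameter `ℓ`-clustering of `p`. -/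
noncomputable def optClusterDiam {n d : ℕ} (p : Fin n → Fin d → Bool) (ℓ : ℕ) : ℕ :=
  ⨅ a : Fin n → Fin ℓ, clusterDiam p a

/-! ### The procedure and its modification -/

/-- The number of rows `k` of the random matrix, of order `log n / δ²`;
`c` is the constant hidden in `k = O(log n / δ²)`. -/
noncomputable def projDim (c n : ℕ) (δ : ℝ) : ℕ :=
  ⌈(c : ℝ) * (Nat.clog 2 n : ℝ) / δ ^ 2⌉₊

/-- Independent fair coins. -/
noncomputable def fairCoins : Measure (ℕ → Bool) :=
  Measure.infinitePi fun _ => (PMF.uniformOfFintype Bool).toMeasure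

/-- The `k × d` matrix with entries in `{-1,1}`, drawn row by row from the coins `ω`. -/
def signMatrix (k d : ℕ) (ω : ℕ → Bool) : Matrix (Fin k) (Fin d) ℤ :=
  fun i j => if ω (i * d + j) then 1 else -1

/-- `f(x) = R xᵀ` for `x ∈ {0,1}^d`. -/
def proj {k d : ℕ} (R : Matrix (Fin k) (Fin d) ℤ) (x : Fin d → Bool) : Fin k → ℤ :=
  R.mulVec fun j => if x j then 1 else 0

/-- `W_{ij} = ‖f(p_i) - f(p_j)‖₂²`. -/
def sqDist {n k d : ℕ} (R : Matrix (Fin k) (Fin d) ℤ) (p : Fin n → Fin d → Bool)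
    (i j : Fin n) : ℤ :=
  ∑ t : Fin k, (proj R (p i) t - proj R (p j) t) ^ 2

/-- `T 0, …, T (ℓ-1)` are (the indices of) the centers in the order in which a farthest-point
traversal with respect to `W` picks them: the first one is the first point, and each later one
is a not yet chosen point that maximizes the minimum of `W` to the centers chosen before it.
Ties are broken arbitrarily. -/
structure IsTraversal {n ℓ : ℕ} (W : Fin n → Fin n → ℤ) (T : Fin ℓ → Fin n) : Prop where
  first : ∀ j : Fin ℓ, j.val = 0 → (T j).val = 0
  fresh : ∀ i j : Fin ℓ, i < j → T i ≠ T j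
  farthest : ∀ j : Fin ℓ, 0 < j.val → ∀ m : Fin n, (∀ i < j, T i ≠ m) →
    (⨅ i : Set.Iio j, W (T i) m) ≤ (⨅ i : Set.Iio j, W (T i) (T j))

/-- `T` is a possible output of the procedure with parameter `δ` (and hidden constant `c`)
on the points `p` with coins `ω`. -/
def DimRedHamCenter (c : ℕ) {n d ℓ : ℕ} (p : Fin n → Fin d → Bool) (δ : ℝ) (ω : ℕ → Bool)
    (T : Fin ℓ → Fin n) : Prop :=
  IsTraversal (sqDist (signMatrix (projDim c n δ) d ω) p) T

/-- `a` is a possible output of the modified procedure: for some output `T` of the procedure,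
each point is put in the cluster of a center that is closest to it with respect to `W`
(a center is put in its own cluster). -/
def DimRedHamCluster (c : ℕ) {n d ℓ : ℕ} (p : Fin n → Fin d → Bool) (δ : ℝ) (ω : ℕ → Bool)
    (a : Fin n → Fin ℓ) : Prop :=
  ∃ T : Fin ℓ → Fin n, DimRedHamCenter c p δ ω T ∧ (∀ i, a (T i) = i) ∧
    ∀ v i, sqDist (signMatrix (projDim c n δ) d ω) p (T (a v)) v ≤
      sqDist (signMatrix (projDim c n δ) d ω) p (T i) v

/-! ### The machine model: a random access machine with unit-cost arithmetic

The machine has integer registers, integer arrays, real registers (needed for the real input `δ`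
only; as usual they admit ring operations and comparisons, but no rounding), and fair coins. -/

namespace RAM

structure State where
  int : ℕ → ℤ
  mem : ℕ → ℤ → ℤ
  real : ℕ → ℝ
  coins : ℕ → Bool

inductive Op
  | add
  | sub
  | mul

def Op.eval {A : Type} [Ring A] : Op → A → A → A
  | .add, x, y => x + y
  | .sub, x, y => x - y
  | .mul, x, y => x * y

inductive Instr
  /-- `x := z` for a literal `z` -/
  | const (x : ℕ) (z : ℤ)
  /-- `x := y o z` -/
  | arith (o : Op) (x y z : ℕ)
  /-- `x := A[y]` -/
  | load (x A y : ℕ)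
  /-- `A[x] := y` -/
  | store (A x y : ℕ)
  /-- `x :=` a fresh random bit -/
  | flip (x : ℕ)
  /-- real register `r :=` integer register `x` -/
  | cast (r x : ℕ)
  /-- `r := s o t` on real registers -/
  | realArith (o : Op) (r s t : ℕ)

noncomputable def Instr.exec (s : State) : Instr → State
  | .const x z => { s with int := Function.update s.int x z }
  | .arith o x y z => { s with int := Function.update s.int x (o.eval (s.int y) (s.int z)) }
  | .load x A y => { s with int := Function.update s.int x (s.mem A (s.int y)) }
  | .store A x y =>
    { s with mem := Function.update s.mem A (Function.update (s.mem A) (s.int x) (s.int y)) }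
  | .flip x =>
    { s with
      int := Function.update s.int x (if s.coins 0 then 1 else 0)
      coins := fun i => s.coins (i + 1) }
  | .cast r x => { s with real := Function.update s.real r (s.int x : ℝ) }
  | .realArith o r a b =>
    { s with real := Function.update s.real r (o.eval (s.real a) (s.real b)) }

inductive Test
  /-- comparison of integer registers -/
  | lt (x y : ℕ)
  /-- comparison of real registers -/
  | realLt (r s : ℕ)

def Test.Holds (s : State) : Test → Prop
  | .lt x y => s.int x < s.int y
  | .realLt a b => s.real a < s.real b

inductive Cmd
  | instr (i : Instr)
  | seq (a b : Cmd)
  | ite (t : Test) (a b : Cmd)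
  | loop (t : Test) (a : Cmd)

open Classical in
/-- One step of the machine; a configuration consists of the commands still to be executed and
the state. `loop t a` is the command `while t do a`. -/
noncomputable def step : List Cmd × State → List Cmd × State
  | ([], s) => ([], s)
  | (.instr i :: K, s) => (K, i.exec s)
  | (.seq a b :: K, s) => (a :: b :: K, s)
  | (.ite t a b :: K, s) => if t.Holds s then (a :: K, s) else (b :: K, s)
  | (.loop t a :: K, s) => if t.Holds s then (a :: .loop t a :: K, s) else (K, s)

/-- Started in `s`, the program `P` halts in state `s'` after at most `B` steps. -/
def HaltsWithin (P : Cmd) (s : State) (B : ℝ) (s' : State) : Prop :=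
  ∃ t : ℕ, (t : ℝ) ≤ B ∧ step^[t] ([P], s) = ([], s')

/-- The state `s` holds the input `n, d, ℓ` in the integer registers `0, 1, 2`, the real `δ` in
the real register `0`, the coordinates of the points row by row in array `0`, and the coins `ω`.
Everything else in `s` is arbitrary. -/
structure Encodes {n d : ℕ} (p : Fin n → Fin d → Bool) (ℓ : ℕ) (δ : ℝ) (ω : ℕ → Bool)
    (s : State) : Prop where
  n_eq : s.int 0 = n
  d_eq : s.int 1 = d
  l_eq : s.int 2 = ℓ
  δ_eq : s.real 0 = δ
  points : ∀ (i : Fin n) (j : Fin d),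
    s.mem 0 ((i.val * d + j.val : ℕ) : ℤ) = if p i j then 1 else 0
  coins_eq : s.coins = ω

/-- In the state `s`, array `A` holds the sequence `x`. -/
def Holds {m r : ℕ} (s : State) (A : ℕ) (x : Fin m → Fin r) : Prop :=
  ∀ i : Fin m, s.mem A (i.val : ℤ) = ((x i).val : ℤ)

end RAM

/-! ### Farthest-point traversals approximate both clustering problems -/

/-! The random matrix enters the approximation guarantees only through `Near`: all values of `W`
agree with `k` times the Hamming distance up to a factor `1 ± δ`.

Deterministic part. Suppose a point is `W`-far from all `ℓ` centers. It was a candidate in every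
round, so each center was at least as far from the earlier ones. The point and the centers are thus
`ℓ + 1` mutually far points, and every partition into `ℓ` clusters joins two of them
(`IsTraversal.exists_same_cluster`). For `δ = ε / 5`, passing from Hamming distances to `W` and back
costs at most a factor `1 + ε / 2` (`Near.mul_le_hammingDist`). For `ℓ`-center this contradicts the
clusters of optimal centers, whose diameters are at most twice the optimum. For minimum diameter it
contradicts an optimal partition, so every point is within `1 + ε / 2` times the optimum of its own
center, and the triangle inequality doubles this.

Probabilistic part. By linearity `W i j` is the squared length of a random sign projection of a
vector whose squared norm is the Hamming distance. The moment bound `sum_exp_sq_le` yields the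
Chernoff bound `card_tail_le`, and a union bound over pairs and tails gives `fairCoins_not_near_le`.
Under `Near` every admissible output is good, so tie-breaking plays no role.

Running time. One program serves both procedures. It stores for each point the closest center so far
and its distance, so a new center costs `O(n k)`; projecting all points costs `O(n k d)`
(`RAM.total_clusterCmd`). -/

/-- `W` approximates `k` times the Hamming distance up to the relative error `δ`. -/
def Near {n d : ℕ} (p : Fin n → Fin d → Bool) (δ : ℝ) (k : ℕ) (W : Fin n → Fin n → ℤ) : Prop :=
  ∀ i j, |(W i j : ℝ) - k * hammingDist (p i) (p j)| ≤ δ * (k * hammingDist (p i) (p j))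

/-- The point `v` was still available when `T j` was chosen, so the minimum distance from the
earlier centers to `T j` is at least that to `v`, which exceeds `w`. -/
theorem IsTraversal.lt_of_lt {n ℓ : ℕ} {W : Fin n → Fin n → ℤ} {T : Fin ℓ → Fin n}
    (hT : IsTraversal W T) {v : Fin n} (hv : ∀ j, T j ≠ v) {w : ℝ}
    (hw : ∀ j, w < W (T j) v) {i j : Fin ℓ} (hij : i < j) : w < W (T i) (T j) := by
  have hj : 0 < j.val := lt_of_le_of_lt (Nat.zero_le _) hij
  have : Nonempty (Set.Iio j) := ⟨⟨i, hij⟩⟩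
  obtain ⟨m, hm⟩ := exists_eq_ciInf_of_finite (f := fun i : Set.Iio j => W (T i) v)
  have h1 := hT.farthest j hj v fun i _ => hv i
  have h2 : (⨅ i : Set.Iio j, W (T i) (T j)) ≤ W (T i) (T j) :=
    ciInf_le (Set.finite_range fun i : Set.Iio j => W (T i) (T j)).bddBelow
      (⟨i, hij⟩ : Set.Iio j)
  rw [← hm] at h1
  exact (hw m).trans_le (by exact_mod_cast h1.trans h2)

/-- If a point is far from all the centers of a traversal, then every partition into `ℓ` clusters
has two far points in one cluster. -/
theorem IsTraversal.exists_same_cluster {n ℓ : ℕ} {W : Fin n → Fin n → ℤ} {T : Fin ℓ → Fin n}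
    (hT : IsTraversal W T) {v : Fin n} (hv : ∀ j, T j ≠ v) {w : ℝ}
    (hw : ∀ j, w < W (T j) v) (a : Fin n → Fin ℓ) : ∃ x y, a x = a y ∧ w < W x y := by
  -- Pigeonhole on `ℓ + 1` points: `none` stands for `v`, `some j` for the center `T j`.
  obtain ⟨x, y, hne, h⟩ := Fintype.exists_ne_map_eq_of_card_lt
    (fun o : Option (Fin ℓ) => a (o.elim v T)) (by simp)
  match x, y, hne, h with
  | none, none, hne, _ => exact absurd rfl hne
  | none, some j, _, h => exact ⟨T j, v, h.symm, hw j⟩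
  | some i, none, _, h => exact ⟨T i, v, h, hw i⟩
  | some i, some j, hne, h =>
    rcases lt_or_gt_of_ne (fun e : i = j => hne (congrArg some e)) with hij | hij
    · exact ⟨T i, T j, h, hT.lt_of_lt hv hw hij⟩
    · exact ⟨T j, T i, h.symm, hT.lt_of_lt hv hw hij⟩

theorem exists_center_le {n d ℓ : ℕ} (hℓ : 1 ≤ ℓ) (p : Fin n → Fin d → Bool)
    (c : Fin ℓ → Fin d → Bool) (v : Fin n) : ∃ u, hammingDist (p v) (c u) ≤ centerCost p c := by
  have : Nonempty (Fin ℓ) := ⟨⟨0, hℓ⟩⟩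
  obtain ⟨u, hu⟩ := exists_eq_ciInf_of_finite (f := fun u => hammingDist (p v) (c u))
  exact ⟨u, hu.trans_le (le_ciSup (f := fun v => ⨅ u, hammingDist (p v) (c u))
    (Set.finite_range _).bddAbove v)⟩

theorem centerCost_le {n d ℓ : ℕ} {p : Fin n → Fin d → Bool} {c : Fin ℓ → Fin d → Bool} {B : ℝ}
    (hB : 0 ≤ B) (h : ∀ v, ∃ u, (hammingDist (p v) (c u) : ℝ) ≤ B) : (centerCost p c : ℝ) ≤ B := by
  rw [← Nat.le_floor_iff hB]
  refine ciSup_le' fun v => ?_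
  obtain ⟨u, hu⟩ := h v
  exact (ciInf_le (OrderBot.bddBelow _) u).trans (Nat.le_floor hu)

theorem exists_centerCost_eq {n d : ℕ} (p : Fin n → Fin d → Bool) (ℓ : ℕ) :
    ∃ c : Fin ℓ → Fin d → Bool, centerCost p c = optCenterCost p ℓ :=
  exists_eq_ciInf_of_finite (f := fun c : Fin ℓ → Fin d → Bool => centerCost p c)

theorem hammingDist_le_clusterDiam {n d ℓ : ℕ} (p : Fin n → Fin d → Bool) (a : Fin n → Fin ℓ)
    {v u : Fin n} (h : a v = a u) : hammingDist (p v) (p u) ≤ clusterDiam p a := by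
  refine le_trans ?_ (le_ciSup (Set.finite_range fun i => ⨆ v : {v : Fin n // a v = i},
    ⨆ u : {u : Fin n // a u = i}, hammingDist (p v) (p u)).bddAbove (a u))
  refine le_trans ?_ (le_ciSup (Set.finite_range fun v : {v : Fin n // a v = a u} =>
    ⨆ w : {w : Fin n // a w = a u}, hammingDist (p v) (p w)).bddAbove ⟨v, h⟩)
  exact le_ciSup (f := fun w : {w : Fin n // a w = a u} => hammingDist (p v) (p w))
    (Set.finite_range _).bddAbove ⟨u, rfl⟩

theorem clusterDiam_le {n d ℓ : ℕ} {p : Fin n → Fin d → Bool} {a : Fin n → Fin ℓ} {B : ℝ}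
    (hB : 0 ≤ B) (h : ∀ v u, a v = a u → (hammingDist (p v) (p u) : ℝ) ≤ B) :
    (clusterDiam p a : ℝ) ≤ B := by
  rw [← Nat.le_floor_iff hB]
  exact ciSup_le' fun i => ciSup_le' fun v => ciSup_le' fun u =>
    Nat.le_floor (h v u (v.2.trans u.2.symm))

theorem exists_clusterDiam_eq {n d ℓ : ℕ} (hℓ : 1 ≤ ℓ) (p : Fin n → Fin d → Bool) :
    ∃ a : Fin n → Fin ℓ, clusterDiam p a = optClusterDiam p ℓ := by
  have : Nonempty (Fin ℓ) := ⟨⟨0, hℓ⟩⟩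
  exact exists_eq_ciInf_of_finite (f := fun a : Fin n → Fin ℓ => clusterDiam p a)

/-! ### Approximation guarantees under `Near` -/

theorem Near.le {n d : ℕ} {p : Fin n → Fin d → Bool} {δ : ℝ} {k : ℕ} {W : Fin n → Fin n → ℤ}
    (h : Near p δ k W) (i j : Fin n) :
    (W i j : ℝ) ≤ (1 + δ) * (k * hammingDist (p i) (p j)) := by
  linarith [(abs_le.1 (h i j)).2]

theorem Near.ge {n d : ℕ} {p : Fin n → Fin d → Bool} {δ : ℝ} {k : ℕ} {W : Fin n → Fin n → ℤ}
    (h : Near p δ k W) (i j : Fin n) :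
    (1 - δ) * (k * hammingDist (p i) (p j)) ≤ (W i j : ℝ) := by
  linarith [(abs_le.1 (h i j)).1]

/-- Common core of both guarantees. The threshold is imposed on `W` rather than on Hamming distances
because in the clustering case only `W` compares the different centers. -/
theorem Near.mul_le_hammingDist {n d ℓ k : ℕ} {p : Fin n → Fin d → Bool} {ε : ℝ}
    {W : Fin n → Fin n → ℤ} {T : Fin ℓ → Fin n} (h : Near p (ε / 5) k W) (hT : IsTraversal W T)
    (hk : 0 < k) (hε : 0 < ε) (hε1 : ε < 1 / 2) {v : Fin n} {r : ℝ} (hr : 0 ≤ r)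
    (hv : ∀ j, (1 - ε / 5) * (k * ((1 + ε / 2) * r)) < W (T j) v) (a : Fin n → Fin ℓ) :
    ∃ x y, a x = a y ∧ r < hammingDist (p x) (p y) := by
  have hk' : (0 : ℝ) < k := by exact_mod_cast hk
  -- By `Near`, a point has `W`-distance at most `0` to itself, while the exceeded threshold is
  -- nonnegative.
  have hne : ∀ j, T j ≠ v := by
    rintro j rfl
    have h1 := hv j
    have h2 := h.le (T j) (T j)
    rw [hammingDist_self] at h2
    have : 0 ≤ (1 - ε / 5) * (k * ((1 + ε / 2) * r)) :=
      mul_nonneg (by linarith) (by positivity)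
    rw [Nat.cast_zero, mul_zero, mul_zero] at h2
    linarith
  obtain ⟨x, y, hxy, hw⟩ := hT.exists_same_cluster hne hv a
  refine ⟨x, y, hxy, ?_⟩
  have h1 := hw.trans_le (h.le x y)
  have h2 : (1 + ε / 5) * (k * r) ≤ (1 - ε / 5) * (k * ((1 + ε / 2) * r)) := by
    -- The right side minus the left side is `ε * (1 - ε) / 10`; this is where the choice `δ = ε /
    -- 5` pays off.
    have : (1 + ε / 5) ≤ (1 - ε / 5) * (1 + ε / 2) := by nlinarith
    nlinarith [mul_le_mul_of_nonneg_right this (mul_nonneg hk'.le hr)]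
  have h3 := lt_of_mul_lt_mul_left (h2.trans_lt h1) (by positivity)
  exact lt_of_mul_lt_mul_left h3 hk'.le

/-- The partition `a` sends each point to an optimal center within the optimal cost, so two points
of one cluster are at distance at most twice the optimum. Hence `r = 2 * optCenterCost p ℓ`, and `(1
+ ε / 2) * r` is the claimed bound. -/
theorem Near.centerCost_le {n d ℓ k : ℕ} {p : Fin n → Fin d → Bool} {ε : ℝ}
    {W : Fin n → Fin n → ℤ} {T : Fin ℓ → Fin n} (h : Near p (ε / 5) k W) (hT : IsTraversal W T)
    (hℓ : 1 ≤ ℓ) (hk : 0 < k) (hε : 0 < ε) (hε1 : ε < 1 / 2) :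
    (centerCost p (fun i => p (T i)) : ℝ) ≤ (2 + ε) * optCenterCost p ℓ := by
  have hk' : (0 : ℝ) < k := by exact_mod_cast hk
  obtain ⟨c, hc⟩ := exists_centerCost_eq p ℓ
  refine _root_.centerCost_le (by positivity) fun v => ?_
  by_contra! hv
  choose a ha using exists_center_le hℓ p c
  rw [hc] at ha
  obtain ⟨x, y, hxy, hlt⟩ := h.mul_le_hammingDist hT hk hε hε1
    (r := 2 * optCenterCost p ℓ) (v := v) (by positivity) (fun j => by
      refine lt_of_lt_of_le ?_ (h.ge (T j) v)
      have := hv j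
      rw [hammingDist_comm] at this
      exact mul_lt_mul_of_pos_left (mul_lt_mul_of_pos_left (by linarith) hk') (by linarith)) a
  have h1 := hammingDist_triangle (p x) (c (a x)) (p y)
  have h2 := ha x
  have h3 := ha y
  rw [← hxy, hammingDist_comm] at h3
  have : hammingDist (p x) (p y) ≤ 2 * optCenterCost p ℓ := by omega
  have : (hammingDist (p x) (p y) : ℝ) ≤ 2 * optCenterCost p ℓ := by exact_mod_cast this
  linarith

theorem Near.clusterDiam_le {n d ℓ k : ℕ} {p : Fin n → Fin d → Bool} {ε : ℝ}
    {W : Fin n → Fin n → ℤ} {T : Fin ℓ → Fin n} (h : Near p (ε / 5) k W) (hT : IsTraversal W T)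
    (hℓ : 1 ≤ ℓ) (hk : 0 < k) (hε : 0 < ε) (hε1 : ε < 1 / 2) {a : Fin n → Fin ℓ}
    (ha : ∀ v i, W (T (a v)) v ≤ W (T i) v) :
    (clusterDiam p a : ℝ) ≤ (2 + ε) * optClusterDiam p ℓ := by
  have hk' : (0 : ℝ) < k := by exact_mod_cast hk
  obtain ⟨b, hb⟩ := exists_clusterDiam_eq hℓ p
  have key : ∀ v, (hammingDist (p (T (a v))) (p v) : ℝ) ≤ (1 + ε / 2) * optClusterDiam p ℓ := by
    intro v
    by_contra! hv
    obtain ⟨x, y, hxy, hlt⟩ := h.mul_le_hammingDist hT hk hε hε1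
      (r := optClusterDiam p ℓ) (v := v) (by positivity) (fun j => by
        -- Only the assigned center is known to be Hamming-far from `v`. As it is closest with
        -- respect to `W`, its lower bound on `W` passes to all centers.
        refine lt_of_lt_of_le ?_ ((h.ge (T (a v)) v).trans (by exact_mod_cast ha v j))
        exact mul_lt_mul_of_pos_left (mul_lt_mul_of_pos_left hv hk') (by linarith)) b
    have := hammingDist_le_clusterDiam p b hxy
    rw [hb] at this
    exact absurd hlt (not_lt.2 (by exact_mod_cast this))
  refine _root_.clusterDiam_le (by positivity) fun v u hvu => ?_
  have h1 : (hammingDist (p v) (p u) : ℝ) ≤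
      hammingDist (p (T (a v))) (p v) + hammingDist (p (T (a v))) (p u) := by
    rw [hammingDist_comm (p (T (a v))) (p v)]
    exact_mod_cast hammingDist_triangle _ _ _
  have h2 := key v
  have h3 := key u
  rw [← hvu] at h3
  linarith

/-! ### Concentration of the squared length of a random sign projection -/

/-- `true ↦ 1`, `false ↦ -1`. -/
def boolSign (b : Bool) : ℤ := if b then 1 else -1

/-- Averaging over one sign gives a `cosh`, and `cosh y ≤ exp (y ^ 2 / 2)` makes the result again an
exponential of a multiple of `x ^ 2`. So signs can be removed one at a time, for `θ` of either sign.
-/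
theorem exp_sq_add_exp_sq_le (θ x a : ℝ) :
    Real.exp (θ * (a + x) ^ 2) + Real.exp (θ * (-a + x) ^ 2) ≤
      2 * (Real.exp (θ * a ^ 2) * Real.exp ((θ + 2 * θ ^ 2 * a ^ 2) * x ^ 2)) := by
  have h := Real.cosh_le_exp_half_sq (2 * θ * a * x)
  rw [Real.cosh_eq] at h
  have e1 : θ * (a + x) ^ 2 = θ * (a ^ 2 + x ^ 2) + 2 * θ * a * x := by ring
  have e2 : θ * (-a + x) ^ 2 = θ * (a ^ 2 + x ^ 2) + -(2 * θ * a * x) := by ring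
  have e3 : θ * a ^ 2 + (θ + 2 * θ ^ 2 * a ^ 2) * x ^ 2 =
      θ * (a ^ 2 + x ^ 2) + (2 * θ * a * x) ^ 2 / 2 := by ring
  rw [← Real.exp_add, e1, e2, e3, Real.exp_add, Real.exp_add, Real.exp_add]
  nlinarith [Real.exp_pos (θ * (a ^ 2 + x ^ 2))]

/-- The moment generating function of the square of a Rademacher sum. -/
theorem sum_exp_sq_le : ∀ {d : ℕ} (a : Fin d → ℝ) (θ : ℝ), |θ| * ∑ j, a j ^ 2 ≤ 1 / 4 →
    ∑ r : Fin d → Bool, Real.exp (θ * (∑ j, boolSign (r j) * a j) ^ 2) ≤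
      2 ^ d * Real.exp (θ * ∑ j, a j ^ 2 + 4 * (θ * ∑ j, a j ^ 2) ^ 2)
  | 0, a, θ, _ => by simp
  | d + 1, a, θ, hθ => by
    rw [Fin.sum_univ_succ] at hθ
    set H := ∑ j : Fin d, a j.succ ^ 2 with hH
    set A := a 0 ^ 2 with hA
    have hA0 : 0 ≤ A := sq_nonneg _
    have hH0 : 0 ≤ H := Finset.sum_nonneg fun _ _ => sq_nonneg _
    set θ' := θ + 2 * θ ^ 2 * A with hθ'
    have ht := abs_nonneg θ
    have hsq : θ ^ 2 = |θ| ^ 2 := (sq_abs θ).symm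
    have htA : |θ| * A ≤ 1 / 4 := by nlinarith
    have htH : |θ| * H ≤ 1 / 4 := by nlinarith
    have htA0 : 0 ≤ |θ| * A := by positivity
    have htH0 : 0 ≤ |θ| * H := by positivity
    have habs : |θ'| ≤ |θ| * (1 + 2 * (|θ| * A)) := by
      refine (abs_add_le _ _).trans (le_of_eq ?_)
      rw [abs_of_nonneg (by positivity : 0 ≤ 2 * θ ^ 2 * A), hsq]
      ring
    have hθ'H : |θ'| * H ≤ 1 / 4 := by
      have := mul_le_mul_of_nonneg_right habs hH0
      nlinarith
    have ih := sum_exp_sq_le (fun j : Fin d => a j.succ) θ' hθ'H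
    rw [← (Fin.consEquiv fun _ => Bool).sum_comp, Fintype.sum_prod_type, Fin.sum_univ_succ, ← hA,
      ← hH]
    simp only [Fin.consEquiv_apply, Fintype.sum_bool, Fin.sum_univ_succ, Fin.cons_zero,
      Fin.cons_succ]
    rw [← Finset.sum_add_distrib]
    calc _ ≤ ∑ r : Fin d → Bool, 2 * (Real.exp (θ * A) *
          Real.exp (θ' * (∑ j, boolSign (r j) * a j.succ) ^ 2)) := by
          refine Finset.sum_le_sum fun r _ => ?_
          have := exp_sq_add_exp_sq_le θ (∑ j, boolSign (r j) * a j.succ) (a 0)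
          simpa [boolSign] using this
      _ = 2 * Real.exp (θ * A) *
          ∑ r : Fin d → Bool, Real.exp (θ' * (∑ j, boolSign (r j) * a j.succ) ^ 2) := by
          rw [Finset.mul_sum]
          exact Finset.sum_congr rfl fun _ _ => by ring
      _ ≤ 2 * Real.exp (θ * A) * (2 ^ d * Real.exp (θ' * H + 4 * (θ' * H) ^ 2)) := by
          gcongr
      _ = 2 ^ (d + 1) * Real.exp (θ * A + (θ' * H + 4 * (θ' * H) ^ 2)) := by
          rw [Real.exp_add (θ * A), pow_succ]
          ring
      _ ≤ _ := by
          refine mul_le_mul_of_nonneg_left (Real.exp_le_exp.2 ?_) (by positivity)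
          -- With `x = |θ| * A` and `y = |θ| * H`, the new linear term gains `2 * x * y`. Together
          -- with four times this bound it stays below `4 * (x + y) ^ 2`, with `2 * x * y` to spare.
          have h1 : (θ' * H) ^ 2 ≤ (|θ| * H) ^ 2 + |θ| * A * (|θ| * H) + (|θ| * A) ^ 2 := by
            rw [← sq_abs (θ' * H), abs_mul, abs_of_nonneg hH0]
            have h2 : |θ'| * H ≤ |θ| * H + 2 * (|θ| * A) * (|θ| * H) := by
              have := mul_le_mul_of_nonneg_right habs hH0
              linarith
            have h3 := pow_le_pow_left₀ (by positivity) h2 2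
            nlinarith [mul_nonneg htA0 htH0, mul_nonneg htA0 (mul_nonneg htA0 htH0),
              mul_nonneg htA0 (mul_nonneg htH0 (sub_nonneg.2 htH)),
              mul_nonneg (mul_nonneg htA0 htA0) (sub_nonneg.2 htH),
              mul_nonneg (mul_nonneg htA0 htA0) (mul_nonneg htH0 (sub_nonneg.2 htH))]
          have e1 : (θ * (A + H)) ^ 2 = (|θ| * A) ^ 2 + 2 * (|θ| * A * (|θ| * H)) +
              (|θ| * H) ^ 2 := by
            rw [← sq_abs, abs_mul, abs_of_nonneg (add_nonneg hA0 hH0)]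
            ring
          have e2 : θ' * H = θ * H + 2 * (|θ| * A * (|θ| * H)) := by
            rw [hθ', hsq]
            ring
          rw [e1]
          nlinarith [mul_nonneg htA0 htH0]

/-- Independence of the rows: the sum over all matrices is the `k`-th power of the sum over one row.
-/
theorem sum_exp_sum_sq_le {d : ℕ} (k : ℕ) (a : Fin d → ℝ) (θ : ℝ)
    (hθ : |θ| * ∑ j, a j ^ 2 ≤ 1 / 4) :
    ∑ b : Fin k → Fin d → Bool, Real.exp (θ * ∑ t, (∑ j, boolSign (b t j) * a j) ^ 2) ≤
      2 ^ (k * d) * Real.exp (k * (θ * ∑ j, a j ^ 2 + 4 * (θ * ∑ j, a j ^ 2) ^ 2)) := by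
  simp only [Finset.mul_sum, Real.exp_sum]
  simp only [← Finset.mul_sum]
  rw [← Fintype.sum_pow (f := fun r : Fin d → Bool =>
    Real.exp (θ * (∑ j, boolSign (r j) * a j) ^ 2)), Real.exp_nat_mul, mul_comm k d, pow_mul,
    ← mul_pow]
  exact pow_le_pow_left₀ (Finset.sum_nonneg fun _ _ => (Real.exp_pos _).le) (sum_exp_sq_le a θ hθ) k

/-- The Chernoff bound; `s = ± 1` selects the tail. -/
theorem card_tail_le {d : ℕ} (k : ℕ) (a : Fin d → ℝ) {δ s : ℝ} (hδ : 0 ≤ δ) (hδ1 : δ ≤ 2)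
    (hs : |s| = 1) (hH : 0 < ∑ j, a j ^ 2) (S : Finset (Fin k → Fin d → Bool))
    (hS : ∀ b ∈ S, δ * (k * ∑ j, a j ^ 2) ≤
      s * (∑ t, (∑ j, boolSign (b t j) * a j) ^ 2 - k * ∑ j, a j ^ 2)) :
    (#S : ℝ) ≤ 2 ^ (k * d) * Real.exp (-(k * δ ^ 2 / 16)) := by
  set H := ∑ j, a j ^ 2
  -- This makes `θ * H = s * δ / 8`, of absolute value at most `1 / 4` as `δ ≤ 2`. A deviation
  -- contributes `k * δ ^ 2 / 8` to the exponent and the quadratic moment term takes back half of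
  -- it.
  set θ := s * δ / (8 * H) with hθ
  have hθH : θ * H = s * (δ / 8) := by
    rw [hθ]
    field_simp
  have hs2 : s ^ 2 = 1 := by rw [← sq_abs, hs, one_pow]
  have hθ1 : |θ| * H ≤ 1 / 4 := by
    have h := congrArg abs hθH
    rw [abs_mul, abs_mul, abs_of_pos hH, hs, abs_of_nonneg (by positivity : 0 ≤ δ / 8)] at h
    linarith
  have h1 := sum_exp_sum_sq_le k a θ hθ1
  have h2 : #S * Real.exp (θ * (k * H) + k * δ ^ 2 / 8) ≤
      2 ^ (k * d) * Real.exp (k * (θ * H + 4 * (θ * H) ^ 2)) := by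
    refine le_trans ?_ h1
    rw [← nsmul_eq_mul]
    refine (Finset.card_nsmul_le_sum S _ _ fun b hb => ?_).trans
      (Finset.sum_le_univ_sum_of_nonneg fun _ => (Real.exp_pos _).le)
    rw [Real.exp_le_exp]
    have h3 := mul_le_mul_of_nonneg_left (hS b hb) (by positivity : 0 ≤ δ / (8 * H))
    have e1 : δ / (8 * H) * (δ * (k * H)) = k * δ ^ 2 / 8 := by
      field_simp
    have e2 : ∀ x, δ / (8 * H) * (s * x) = θ * x := fun x => by
      rw [hθ]
      ring
    rw [e1, e2, mul_sub] at h3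
    linarith
  have e : k * (θ * H + 4 * (θ * H) ^ 2) =
      (θ * (k * H) + k * δ ^ 2 / 8) + -(k * δ ^ 2 / 16) := by
    rw [mul_left_comm θ (k : ℝ) H, hθH, mul_pow, hs2]
    ring
  rw [e, Real.exp_add _ (-_), mul_comm (#S : ℝ), mul_left_comm (2 ^ (k * d) : ℝ)] at h2
  exact le_of_mul_le_mul_left h2 (Real.exp_pos _)

/-! ### Fair coins and the uniform sign matrix -/

instance : IsProbabilityMeasure fairCoins := by
  unfold fairCoins
  infer_instance

theorem fairCoins_cylinder {ι : Type*} [Fintype ι] (e : ι → ℕ) (he : Function.Injective e)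
    (b : ι → Bool) : fairCoins {ω | ∀ i, ω (e i) = b i} = (2⁻¹ : ENNReal) ^ Fintype.card ι := by
  classical
  have h := Measure.infinitePi_pi (fun _ : ℕ => (PMF.uniformOfFintype Bool).toMeasure)
    -- The side at coordinate `m` is written without an inverse of `e`; injectivity makes it the
    -- singleton `{b i}` at `m = e i`.
    (s := Finset.univ.image e) (t := fun m => {x | ∀ i, e i = m → x = b i})
    (fun _ _ => MeasurableSet.of_discrete)
  have hset : {ω : ℕ → Bool | ∀ i, ω (e i) = b i} =
      Set.pi (Finset.univ.image e : Finset ℕ) (fun m => {x | ∀ i, e i = m → x = b i}) := by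
    ext ω
    simp only [Set.mem_ofPred_eq, Set.mem_pi, Finset.coe_image, Finset.coe_univ, Set.image_univ,
      Set.mem_range, forall_exists_index]
    exact ⟨fun h m j hj i hi => hi ▸ h i, fun h i => h _ i rfl i rfl⟩
  rw [fairCoins, hset, h, Finset.prod_image fun _ _ _ _ h => he h, ← Finset.card_univ,
    ← Finset.prod_const]
  refine Finset.prod_congr rfl fun i _ => ?_
  have : {x | ∀ j, e j = e i → x = b j} = {b i} := by
    ext x
    simp only [Set.mem_ofPred_eq, Set.mem_singleton_iff]
    exact ⟨fun h => h i rfl, fun h j hj => he hj ▸ h⟩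
  rw [this, PMF.toMeasure_apply_singleton _ _ (measurableSet_singleton _)]
  simp

/-- The first `k * d` coins, arranged row by row. -/
def coinRows (k d : ℕ) (ω : ℕ → Bool) (t : Fin k) (j : Fin d) : Bool := ω (t * d + j)

theorem fairCoins_coinRows_le {k d : ℕ} (S : Finset (Fin k → Fin d → Bool)) :
    fairCoins.real {ω | coinRows k d ω ∈ S} ≤ #S / 2 ^ (k * d) := by
  have h1 : ∀ b : Fin k → Fin d → Bool,
      fairCoins.real {ω | coinRows k d ω = b} = (2 ^ (k * d))⁻¹ := fun b => by
    have he : Function.Injective fun q : Fin k × Fin d => q.1.val * d + q.2.val := by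
      intro q q' h
      have : finProdFinEquiv q = finProdFinEquiv q' := by
        apply Fin.ext
        simp only [finProdFinEquiv_apply_val]
        linarith [h, mul_comm q.1.val d, mul_comm q'.1.val d]
      exact finProdFinEquiv.injective this
    have := fairCoins_cylinder _ he fun q => b q.1 q.2
    have hs : {ω | coinRows k d ω = b} =
        {ω : ℕ → Bool | ∀ q : Fin k × Fin d, ω (q.1.val * d + q.2.val) = b q.1 q.2} := by
      ext ω
      simp [funext_iff, coinRows]
    rw [hs, Measure.real, this]
    simp
  have h2 : {ω | coinRows k d ω ∈ S} = ⋃ b ∈ S, {ω | coinRows k d ω = b} := by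
    ext ω
    simp
  rw [h2]
  refine (measureReal_biUnion_finset_le S _).trans (le_of_eq ?_)
  simp [h1, div_eq_mul_inv]

/-! ### Union bound for all pairwise distances -/

theorem hammingDist_eq_sum_sq {d : ℕ} (x y : Fin d → Bool) :
    (hammingDist x y : ℝ) =
      ∑ j, ((if x j then (1 : ℝ) else 0) - (if y j then (1 : ℝ) else 0)) ^ 2 := by
  rw [hammingDist, Finset.card_eq_sum_ones, Finset.sum_filter]
  push_cast
  refine Finset.sum_congr rfl fun j _ => ?_
  cases x j <;> cases y j <;> simp

/-- Linearity of the projection: only the difference vector matters, and its squared norm is given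
by `hammingDist_eq_sum_sq`. -/
theorem sqDist_signMatrix {n k d : ℕ} (p : Fin n → Fin d → Bool) (ω : ℕ → Bool) (u v : Fin n) :
    (sqDist (signMatrix k d ω) p u v : ℝ) = ∑ t, (∑ j, boolSign (coinRows k d ω t j) *
      ((if p u j then (1 : ℝ) else 0) - (if p v j then (1 : ℝ) else 0))) ^ 2 := by
  simp only [sqDist, proj, Matrix.mulVec, dotProduct, ← Finset.sum_sub_distrib, ← mul_sub]
  push_cast
  rfl

/-- The factor `n ^ 2` counts ordered pairs and the factor `2` counts the upper and lower tails,
selected by `s = ± 1` in `B`. -/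
theorem fairCoins_not_near_le {n d : ℕ} (k : ℕ) (p : Fin n → Fin d → Bool) {δ : ℝ} (hδ : 0 ≤ δ)
    (hδ1 : δ ≤ 2) :
    fairCoins.real {ω | ¬ Near p δ k (sqDist (signMatrix k d ω) p)} ≤
      2 * n ^ 2 * Real.exp (-(k * δ ^ 2 / 16)) := by
  classical
  let B (s : ℝ) (q : Fin n × Fin n) : Set (ℕ → Bool) :=
    {ω | δ * (k * hammingDist (p q.1) (p q.2)) < s *
      ((sqDist (signMatrix k d ω) p q.1 q.2 : ℝ) - k * hammingDist (p q.1) (p q.2))}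
  have hB : ∀ s : ℝ, |s| = 1 → ∀ q, fairCoins.real (B s q) ≤ Real.exp (-(k * δ ^ 2 / 16)) := by
    intro s hs q
    simp only [B, hammingDist_eq_sum_sq, sqDist_signMatrix]
    set a : Fin d → ℝ := fun j =>
      (if p q.1 j then (1 : ℝ) else 0) - (if p q.2 j then (1 : ℝ) else 0) with ha
    -- The Chernoff bound needs a nonzero vector; for coinciding points both sides of the strict
    -- inequality vanish and the bad event is empty.
    rcases (Finset.sum_nonneg fun j _ => sq_nonneg (a j) : 0 ≤ ∑ j, a j ^ 2).eq_or_lt with h0 | h0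
    · have ha0 : ∀ j, a j = 0 := fun j => by
        simpa using (Finset.sum_eq_zero_iff_of_nonneg fun j _ => sq_nonneg (a j)).1 h0.symm j
          (Finset.mem_univ j)
      have : ∀ j, ((if p q.1 j then (1 : ℝ) else 0) - (if p q.2 j then (1 : ℝ) else 0)) = 0 := ha0
      simp only [this]
      simp [Real.exp_nonneg]
    · have h1 := fairCoins_coinRows_le (k := k) (d := d) (Finset.univ.filter fun b =>
        δ * (k * ∑ j, a j ^ 2) <
          s * (∑ t, (∑ j, boolSign (b t j) * a j) ^ 2 - k * ∑ j, a j ^ 2))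
      have h2 := card_tail_le k a hδ hδ1 hs h0 (Finset.univ.filter fun b =>
        δ * (k * ∑ j, a j ^ 2) <
          s * (∑ t, (∑ j, boolSign (b t j) * a j) ^ 2 - k * ∑ j, a j ^ 2))
        fun b hb => (Finset.mem_filter.1 hb).2.le
      simp only [Finset.mem_filter, Finset.mem_univ, true_and] at h1
      refine h1.trans ?_
      rwa [div_le_iff₀' (by positivity)]
  have hsub : {ω | ¬ Near p δ k (sqDist (signMatrix k d ω) p)} ⊆
      ⋃ q ∈ (Finset.univ : Finset (Fin n × Fin n)), (B 1 q ∪ B (-1) q) := by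
    intro ω hω
    simp only [Near, Set.mem_ofPred_eq, not_forall, not_le] at hω
    obtain ⟨i, j, hij⟩ := hω
    refine Set.mem_biUnion (x := (i, j)) (Finset.mem_coe.2 (Finset.mem_univ _)) ?_
    rcases lt_abs.1 hij with h | h
    · exact Or.inl (by simpa [B] using h)
    · exact Or.inr (by simpa [B] using h)
  calc _ ≤ fairCoins.real (⋃ q ∈ (Finset.univ : Finset (Fin n × Fin n)), (B 1 q ∪ B (-1) q)) :=
        measureReal_mono hsub (measure_ne_top _ _)
    _ ≤ ∑ q : Fin n × Fin n, fairCoins.real (B 1 q ∪ B (-1) q) :=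
        measureReal_biUnion_finset_le _ _
    _ ≤ ∑ q : Fin n × Fin n, 2 * Real.exp (-(k * δ ^ 2 / 16)) := by
        refine Finset.sum_le_sum fun q _ => (measureReal_union_le _ _).trans ?_
        linarith [hB 1 (by simp) q, hB (-1) (by simp) q]
    _ = _ := by
        simp
        ring

/-! ### From concentration to failure probability `n ^ (-α)` -/

/-- Only monotonicity and subadditivity enter, so the success event need not be shown measurable. -/
theorem one_sub_le_fairCoins {A B : Set (ℕ → Bool)} (h : ∀ ω, ω ∉ A → ω ∈ B) :
    1 - fairCoins.real A ≤ fairCoins.real B := by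
  have h1 : fairCoins.real (Set.univ) ≤ fairCoins.real (A ∪ B) :=
    measureReal_mono fun ω _ => (em (ω ∈ A)).imp id (h ω)
  have h2 := measureReal_union_le (μ := fairCoins) A B
  rw [probReal_univ] at h1
  linarith

/-- The exponential is at most `n ^ (-(α + 3))`. Two of the three extra powers absorb `n ^ 2`, and
the third absorbs the factor `2` since `n ≥ 2`. -/
theorem mul_sq_exp_le_rpow {n c k : ℕ} {α δ : ℝ} (hn : 2 ≤ n)
    (hc : 16 * (α + 3) ≤ c) (hk : c * Real.log n ≤ k * δ ^ 2) :
    2 * (n : ℝ) ^ 2 * Real.exp (-(k * δ ^ 2 / 16)) ≤ (n : ℝ) ^ (-α) := by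
  have hn' : (2 : ℝ) ≤ n := by exact_mod_cast hn
  have hn0 : (0 : ℝ) < n := by linarith
  have hlog : 0 ≤ Real.log n := Real.log_nonneg (by linarith)
  have h1 : Real.exp (-(k * δ ^ 2 / 16)) ≤ (n : ℝ) ^ (-(α + 3)) := by
    rw [Real.rpow_def_of_pos hn0, Real.exp_le_exp]
    nlinarith [mul_le_mul_of_nonneg_right hc hlog]
  have h2 : (n : ℝ) ^ (-α) = (n : ℝ) ^ 3 * (n : ℝ) ^ (-(α + 3)) := by
    rw [← Real.rpow_natCast, ← Real.rpow_add hn0]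
    congr 1
    push_cast
    ring
  rw [h2]
  refine mul_le_mul ?_ h1 (Real.exp_pos _).le (by positivity)
  nlinarith [sq_nonneg (n : ℝ)]

theorem log_le_clog (n : ℕ) (hn : 2 ≤ n) : Real.log n ≤ Nat.clog 2 n := by
  have h1 : (n : ℝ) ≤ 2 ^ Nat.clog 2 n := by exact_mod_cast Nat.le_pow_clog one_lt_two n
  have h2 := Real.log_le_log (by positivity : (0 : ℝ) < n) h1
  rw [Real.log_pow] at h2
  nlinarith [Real.log_two_lt_d9, (Nat.cast_nonneg (Nat.clog 2 n) : (0 : ℝ) ≤ _)]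

theorem mul_clog_le_projDim {c n : ℕ} {δ : ℝ} (hδ : 0 < δ) :
    c * (Nat.clog 2 n : ℝ) ≤ projDim c n δ * δ ^ 2 := by
  rw [← div_le_iff₀ (by positivity)]
  exact Nat.le_ceil _

theorem projDim_pos {c n : ℕ} {δ : ℝ} (hδ : 0 < δ) (hn : 2 ≤ n) (hc : 1 ≤ c) :
    0 < projDim c n δ := by
  have := Nat.clog_pos one_lt_two hn
  exact Nat.ceil_pos.2 (by positivity)

theorem one_sub_rpow_le_of_near {n d c : ℕ} (p : Fin n → Fin d → Bool) {α ε : ℝ}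
    (hn : 2 ≤ n) (hc : 16 * (α + 3) ≤ c) (hε : 0 < ε) (hε1 : ε < 1 / 2) {B : Set (ℕ → Bool)}
    (hB : ∀ ω, Near p (ε / 5) (projDim c n (ε / 5))
      (sqDist (signMatrix (projDim c n (ε / 5)) d ω) p) → ω ∈ B) :
    1 - (n : ℝ) ^ (-α) ≤ fairCoins.real B := by
  have h1 := fairCoins_not_near_le (projDim c n (ε / 5)) p (δ := ε / 5) (by positivity)
    (by linarith)
  have h2 := mul_sq_exp_le_rpow (k := projDim c n (ε / 5)) (δ := ε / 5) hn hc
    ((mul_le_mul_of_nonneg_left (log_le_clog n hn) (by positivity)).trans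
      (mul_clog_le_projDim (by positivity)))
  have h3 := one_sub_le_fairCoins
    (A := {ω | ¬ Near p (ε / 5) (projDim c n (ε / 5))
      (sqDist (signMatrix (projDim c n (ε / 5)) d ω) p)}) (B := B)
    fun ω hω => hB ω (not_not.1 hω)
  linarith

namespace RAM

/-! ### Total correctness with time bounds -/

/-- The command `P`, started in `s`, finishes after exactly `t` steps in the state `s'`. -/
def Runs (P : Cmd) (s : State) (t : ℕ) (s' : State) : Prop :=
  ∀ K, step^[t] (P :: K, s) = (K, s')

/-- The command `P`, started in `s`, finishes after at most `B` steps in a state satisfying `Q`. -/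
def Total (P : Cmd) (s : State) (B : ℕ) (Q : State → Prop) : Prop :=
  ∃ t ≤ B, ∃ s', Runs P s t s' ∧ Q s'

theorem Runs.instr (i : Instr) (s : State) : Runs (.instr i) s 1 (i.exec s) := fun _ => rfl

theorem Runs.seq {a b : Cmd} {s s₁ s₂ : State} {t₁ t₂ : ℕ} (h₁ : Runs a s t₁ s₁)
    (h₂ : Runs b s₁ t₂ s₂) : Runs (.seq a b) s (t₂ + t₁ + 1) s₂ := fun K => by
  rw [Function.iterate_add_apply, Function.iterate_one, Function.iterate_add_apply]
  exact (congrArg _ (h₁ (b :: K))).trans (h₂ K)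

theorem Runs.ite_pos {c : Test} {a b : Cmd} {s s' : State} {t : ℕ} (hc : c.Holds s)
    (h : Runs a s t s') : Runs (.ite c a b) s (t + 1) s' := fun K => by
  rw [Function.iterate_add_apply, Function.iterate_one, step, if_pos hc]
  exact h K

theorem Runs.ite_neg {c : Test} {a b : Cmd} {s s' : State} {t : ℕ} (hc : ¬ c.Holds s)
    (h : Runs b s t s') : Runs (.ite c a b) s (t + 1) s' := fun K => by
  rw [Function.iterate_add_apply, Function.iterate_one, step, if_neg hc]
  exact h K

theorem Runs.loop_neg {c : Test} {a : Cmd} {s : State} (hc : ¬ c.Holds s) :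
    Runs (.loop c a) s 1 s := fun K => by
  rw [Function.iterate_one, step, if_neg hc]

theorem Runs.loop_pos {c : Test} {a : Cmd} {s s₁ s₂ : State} {t₁ t₂ : ℕ} (hc : c.Holds s)
    (h₁ : Runs a s t₁ s₁) (h₂ : Runs (.loop c a) s₁ t₂ s₂) :
    Runs (.loop c a) s (t₂ + t₁ + 1) s₂ := fun K => by
  rw [Function.iterate_add_apply, Function.iterate_one, Function.iterate_add_apply, step,
    if_pos hc]
  exact (congrArg _ (h₁ (.loop c a :: K))).trans (h₂ K)

theorem Total.mono {P : Cmd} {s : State} {B B' : ℕ} {Q Q' : State → Prop} (h : Total P s B Q)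
    (hB : B ≤ B') (hQ : ∀ s', Q s' → Q' s') : Total P s B' Q' := by
  obtain ⟨t, ht, s', hr, hq⟩ := h
  exact ⟨t, ht.trans hB, s', hr, hQ s' hq⟩

theorem Total.seq {a b : Cmd} {s : State} {B₁ B₂ B : ℕ} {Q₁ Q : State → Prop}
    (h₁ : Total a s B₁ Q₁) (h₂ : ∀ s₁, Q₁ s₁ → Total b s₁ B₂ Q) (hB : B₁ + B₂ + 1 ≤ B) :
    Total (.seq a b) s B Q := by
  obtain ⟨t₁, ht₁, s₁, hr₁, hq₁⟩ := h₁
  obtain ⟨t₂, ht₂, s₂, hr₂, hq₂⟩ := h₂ s₁ hq₁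
  exact ⟨_, by omega, s₂, hr₁.seq hr₂, hq₂⟩

theorem Total.ite {c : Test} {a b : Cmd} {s : State} {B : ℕ} {Q : State → Prop}
    (h₁ : c.Holds s → Total a s B Q) (h₂ : ¬ c.Holds s → Total b s B Q) :
    Total (.ite c a b) s (B + 1) Q := by
  by_cases hc : c.Holds s
  · obtain ⟨t, ht, s', hr, hq⟩ := h₁ hc
    exact ⟨_, by omega, s', hr.ite_pos hc, hq⟩
  · obtain ⟨t, ht, s', hr, hq⟩ := h₂ hc
    exact ⟨_, by omega, s', hr.ite_neg hc, hq⟩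

/-- A loop with exactly `N` iterations and the invariant `I`. -/
theorem Total.loop {c : Test} {a : Cmd} {N B : ℕ} (I : ℕ → State → Prop) {Q : State → Prop}
    (hstep : ∀ i < N, ∀ s, I i s → c.Holds s ∧ Total a s B (I (i + 1)))
    (hend : ∀ s, I N s → ¬ c.Holds s ∧ Q s) {s : State} (hs : I 0 s) :
    Total (.loop c a) s (N * (B + 1) + 1) Q := by
  -- Induction on the number `m` of iterations that remain, since the loop unfolds at its front.
  suffices ∀ m i s, i + m = N → I i s → Total (.loop c a) s (m * (B + 1) + 1) Q from
    this N 0 s (by omega) hs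
  intro m
  induction m with
  | zero =>
    intro i s hi h
    obtain ⟨hc, hq⟩ := hend s ((show i = N by omega) ▸ h)
    exact ⟨1, by omega, s, Runs.loop_neg hc, hq⟩
  | succ m ih =>
    intro i s hi h
    obtain ⟨hc, t₁, ht₁, s₁, hr₁, hq₁⟩ := hstep i (by omega) s h
    obtain ⟨t₂, ht₂, s₂, hr₂, hq₂⟩ := ih (i + 1) s₁ (by omega) hq₁
    exact ⟨_, by rw [Nat.succ_mul]; omega, s₂, hr₁.loop_pos hc hr₂, hq₂⟩

/-- A nonempty sequence of instructions. -/
def block (i : Instr) : List Instr → Cmd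
  | [] => .instr i
  | j :: l => .seq (.instr i) (block j l)

/-- One step for each instruction and one for unfolding each `seq`. -/
theorem Total.block {Q : State → Prop} : ∀ {i : Instr} {l : List Instr} {s : State},
    Q (l.foldl Instr.exec (i.exec s)) → Total (block i l) s (2 * l.length + 1) Q
  | i, [], s, h => ⟨1, by simp, _, Runs.instr i s, h⟩
  | i, j :: l, s, h => by
    refine Total.seq (B₁ := 1) (Q₁ := fun s₁ => s₁ = i.exec s)
      ⟨1, le_rfl, _, Runs.instr i s, rfl⟩ (fun s₁ h₁ => ?_) (B₂ := 2 * l.length + 1) (by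
        rw [List.length_cons]; omega)
    subst h₁
    exact Total.block h

theorem Total.haltsWithin {P : Cmd} {s : State} {B : ℕ} {Q : State → Prop} (h : Total P s B Q)
    {B' : ℝ} (hB : (B : ℝ) ≤ B') : ∃ s', HaltsWithin P s B' s' ∧ Q s' := by
  obtain ⟨t, ht, s', hr, hq⟩ := h
  exact ⟨s', ⟨t, le_trans (by exact_mod_cast ht) hB, hr []⟩, hq⟩

/-- The registers that all parts of the program share: `n`, `d`, `ℓ`, `0`, `1`, `k`. -/
structure Regs (n d ℓ k : ℕ) (s : State) : Prop where
  n_eq : s.int 0 = n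
  d_eq : s.int 1 = d
  l_eq : s.int 2 = ℓ
  zero_eq : s.int 3 = 0
  one_eq : s.int 4 = 1
  k_eq : s.int 5 = k

theorem Regs.of_eq {n d ℓ k : ℕ} {s s' : State} (h : Regs n d ℓ k s)
    (hs : ∀ x < 6, s'.int x = s.int x) : Regs n d ℓ k s' where
  n_eq := (hs 0 (by omega)).trans h.n_eq
  d_eq := (hs 1 (by omega)).trans h.d_eq
  l_eq := (hs 2 (by omega)).trans h.l_eq
  zero_eq := (hs 3 (by omega)).trans h.zero_eq
  one_eq := (hs 4 (by omega)).trans h.one_eq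
  k_eq := (hs 5 (by omega)).trans h.k_eq

/-! ### The number of rows -/

/-- Computes `⌈log₂ n⌉` in register `6`. -/
def logCmd : Cmd :=
  .seq (block (.const 3 0) [.const 4 1, .const 6 0, .const 7 1])
    (.loop (.lt 7 0) (block (.arith .add 7 7 7) [.arith .add 6 6 4]))

theorem total_logCmd {n : ℕ} {s : State} (hn : s.int 0 = n) :
    Total logCmd s (4 * Nat.clog 2 n + 9) fun s' => s'.int 6 = Nat.clog 2 n ∧
      (∀ x < 3, s'.int x = s.int x) ∧ s'.int 3 = 0 ∧ s'.int 4 = 1 ∧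
      s'.mem = s.mem ∧ s'.real = s.real ∧ s'.coins = s.coins := by
  let I : ℕ → State → Prop := fun i s' => s'.int 6 = i ∧ s'.int 7 = (2 ^ i : ℕ) ∧
      (∀ x < 3, s'.int x = s.int x) ∧ s'.int 3 = 0 ∧ s'.int 4 = 1 ∧
      s'.mem = s.mem ∧ s'.real = s.real ∧ s'.coins = s.coins
  refine Total.seq (Q₁ := I 0) (Total.block ?_) (fun s₁ h₁ => Total.loop (N := Nat.clog 2 n) I
    (fun i hi s' h => ⟨?_, Total.block ?_⟩) (fun s' h => ⟨?_, ?_⟩) h₁) (by simp; omega)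
  · simp +contextual (disch := omega) [I, Instr.exec, Function.update_of_ne]
  · obtain ⟨h6, h7, hx, h3, h4, hm⟩ := h
    rw [Test.Holds, h7, hx 0 (by omega), hn]
    exact_mod_cast (Nat.lt_clog_iff_pow_lt one_lt_two).1 hi
  · obtain ⟨h6, h7, hx, h3, h4, hm⟩ := h
    simp +contextual (disch := omega) [I, Instr.exec, Function.update_of_ne, Op.eval, *]
    ring
  · obtain ⟨h6, h7, hx, h3, h4, hm⟩ := h
    rw [Test.Holds, h7, hx 0 (by omega), hn, not_lt]
    exact_mod_cast Nat.le_pow_clog one_lt_two n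
  · exact ⟨h.1, h.2.2⟩

/-- Computes the number of rows in register `5`. -/
def dimCmd (c : ℕ) : Cmd :=
  .seq logCmd (.seq (block (.const 8 c) [.arith .mul 8 8 6, .cast 2 8, .realArith .mul 1 0 0,
      .const 5 0, .cast 3 5])
    (.loop (.realLt 3 2) (block (.arith .add 5 5 4) [.realArith .add 3 3 1])))

/-- Real registers have neither division nor rounding, so the ceiling is found by counting: real
register `3` holds `i * δ ^ 2`, and the loop stops at the first `i` for which this reaches `c *
Nat.clog 2 n`. -/
theorem total_dimCmd {n d ℓ c : ℕ} {δ : ℝ} {s : State} (hn : s.int 0 = n) (hd : s.int 1 = d)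
    (hℓ : s.int 2 = ℓ) (hδ : s.real 0 = δ) (hδ0 : 0 < δ) :
    Total (dimCmd c) s (4 * Nat.clog 2 n + 4 * projDim c n δ + 23) fun s' =>
      Regs n d ℓ (projDim c n δ) s' ∧ s'.mem = s.mem ∧ s'.coins = s.coins := by
  let I : ℕ → State → Prop := fun i s' => Regs n d ℓ i s' ∧ s'.real 3 = i * δ ^ 2 ∧
    s'.real 1 = δ ^ 2 ∧ s'.real 2 = c * Nat.clog 2 n ∧ s'.mem = s.mem ∧ s'.coins = s.coins
  refine Total.seq (total_logCmd hn) (fun s₁ h₁ => ?_)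
    (B₂ := 4 * projDim c n δ + 13) (by omega)
  obtain ⟨h6, hx, h3, h4, hm, hr, hc⟩ := h₁
  refine Total.seq (Q₁ := I 0) (Total.block ?_) (fun s₂ h₂ => Total.loop (N := projDim c n δ) I
    (fun i hi s' h => ⟨?_, Total.block ?_⟩) (fun s' h => ⟨?_, ?_⟩) h₂) (by simp; omega)
  · refine ⟨⟨?_, ?_, ?_, ?_, ?_, ?_⟩, ?_⟩ <;>
      simp [Instr.exec, Op.eval, *]
    ring
  · obtain ⟨hR, h3, h1, h2, hm⟩ := h
    rw [Test.Holds, h3, h2, ← lt_div_iff₀ (by positivity)]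
    exact Nat.lt_ceil.1 hi
  · obtain ⟨hR, h3, h1, h2, hm, hc⟩ := h
    refine ⟨⟨?_, ?_, ?_, ?_, ?_, ?_⟩, ?_⟩ <;>
      simp [Instr.exec, Op.eval, hR.n_eq, hR.d_eq, hR.l_eq, hR.zero_eq, hR.one_eq, hR.k_eq, *]
    ring
  · obtain ⟨hR, h3, h1, h2, hm⟩ := h
    rw [Test.Holds, h3, h2, not_lt]
    exact mul_clog_le_projDim hδ0
  · exact ⟨h.1, h.2.2.2.2⟩

/-! ### The random matrix -/

/-- Fills array `3` with `k * d` random signs. -/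
def matrixCmd : Cmd :=
  .seq (block (.arith .mul 7 5 1) [.const 6 0])
    (.loop (.lt 6 7) (block (.flip 8) [.arith .add 8 8 8, .arith .sub 8 8 4, .store 3 6 8,
      .arith .add 6 6 4]))

/-- A flip consumes the head of the coin stream, so after `i` flips the remaining coins are the
original ones shifted by `i`. The sign is twice the bit minus one. -/
theorem total_matrixCmd {n d ℓ k : ℕ} {s : State} (hR : Regs n d ℓ k s) :
    Total matrixCmd s (10 * (k * d) + 5) fun s' => Regs n d ℓ k s' ∧
      (∀ A ≠ 3, s'.mem A = s.mem A) ∧ ∀ q < k * d, s'.mem 3 (q : ℕ) = boolSign (s.coins q) := by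
  let I : ℕ → State → Prop := fun i s' => (∀ x < 6, s'.int x = s.int x) ∧ s'.int 6 = i ∧
    s'.int 7 = (k * d : ℕ) ∧ (∀ m, s'.coins m = s.coins (m + i)) ∧
    (∀ A ≠ 3, s'.mem A = s.mem A) ∧ ∀ q < i, s'.mem 3 (q : ℕ) = boolSign (s.coins q)
  refine Total.seq (Q₁ := I 0) (Total.block ?_) (fun s₁ h₁ => Total.loop (N := k * d) I
    (fun i hi s' h => ⟨?_, Total.block ?_⟩) (fun s' h => ⟨?_, ?_⟩) h₁) (by simp; omega)
  · simp +contextual (disch := omega) [I, Instr.exec, Function.update_of_ne, Op.eval, hR.k_eq,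
      hR.d_eq]
  · rw [Test.Holds, h.2.1, h.2.2.1]
    exact_mod_cast hi
  · obtain ⟨hx, h6, h7, hc, hm, h3⟩ := h
    have h4 := (hx 4 (by omega)).trans hR.one_eq
    refine ⟨fun x hx' => ?_, ?_, ?_, fun m => ?_, fun A hA => ?_, fun q hq => ?_⟩
    · simp (disch := omega) [Instr.exec, Function.update_of_ne, hx x hx']
    · simp [Instr.exec, Op.eval, h6, h4]
    · simp [Instr.exec, h7]
    · simp [Instr.exec, hc, add_assoc, add_comm 1]
    · simp [Instr.exec, Function.update_of_ne hA, hm A hA]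
    · rcases (Nat.lt_succ_iff.1 hq).eq_or_lt with rfl | hq'
      · simp [Instr.exec, Op.eval, h6, h4, hc, boolSign]
        split <;> rfl
      · have : (q : ℤ) ≠ i := by omega
        simp [Instr.exec, h6, Function.update_of_ne this, h3 q hq']
  · rw [Test.Holds, h.2.1, h.2.2.1]
    exact lt_irrefl _
  · exact ⟨hR.of_eq h.1, h.2.2.2.2⟩

/-! ### The projections of the points -/

/-- Puts `∑ j < d, R[t * d + j] * P[i * d + j]` into register `9`; here `i` and `t` are the
registers `6` and `7`. -/
def dotCmd : Cmd :=
  .seq (block (.const 8 0) [.const 9 0])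
    (.loop (.lt 8 1) (block (.arith .mul 10 7 1) [.arith .add 10 10 8, .load 10 3 10,
      .arith .mul 11 6 1, .arith .add 11 11 8, .load 11 0 11, .arith .mul 10 10 11,
      .arith .add 9 9 10, .arith .add 8 8 4]))

/-- The scalar product of row `t` of array `3` and row `i` of array `0`. -/
def dot (d : ℕ) (M : ℕ → ℤ → ℤ) (i t : ℕ) : ℤ :=
  ∑ j ∈ range d, M 3 (t * d + j : ℕ) * M 0 (i * d + j : ℕ)

theorem total_dotCmd {n d ℓ k i t : ℕ} {s : State} (hR : Regs n d ℓ k s) (h6 : s.int 6 = i)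
    (h7 : s.int 7 = t) : Total dotCmd s (18 * d + 5) fun s' =>
      (∀ x < 8, s'.int x = s.int x) ∧ s'.mem = s.mem ∧ s'.int 9 = dot d s.mem i t := by
  let I : ℕ → State → Prop := fun j s' => (∀ x < 8, s'.int x = s.int x) ∧ s'.mem = s.mem ∧
    s'.int 9 = ∑ j ∈ range j, s.mem 3 (t * d + j : ℕ) * s.mem 0 (i * d + j : ℕ) ∧ s'.int 8 = j
  refine Total.seq (Q₁ := I 0) (Total.block ?_) (fun s₁ h₁ => Total.loop (N := d) I
    (fun j hj s' h => ⟨?_, Total.block ?_⟩) (fun s' h => ⟨?_, ?_⟩) h₁) (by simp; omega)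
  · simp +contextual (disch := omega) [I, Instr.exec, Function.update_of_ne]
  · rw [Test.Holds, h.2.2.2, h.1 1 (by omega), hR.d_eq]
    exact_mod_cast hj
  · obtain ⟨hx, hm, h9, h8⟩ := h
    have e1 := (hx 1 (by omega)).trans hR.d_eq
    have e4 := (hx 4 (by omega)).trans hR.one_eq
    have e6 := (hx 6 (by omega)).trans h6
    have e7 := (hx 7 (by omega)).trans h7
    refine ⟨fun x hx' => ?_, ?_, ?_, ?_⟩
    · simp (disch := omega) [Instr.exec, Function.update_of_ne, hx x hx']
    · simp [Instr.exec, hm]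
    · simp [Instr.exec, Op.eval, Finset.sum_range_succ, h9, h8, hm, e1, e4, e6, e7]
    · simp [Instr.exec, Op.eval, h8, e4]
  · rw [Test.Holds, h.2.2.2, h.1 1 (by omega), hR.d_eq]
    exact lt_irrefl _
  · exact ⟨h.1, h.2.1, h.2.2.1⟩

/-- Fills row `i` of array `4`, where `i` is register `6`. -/
def rowCmd : Cmd :=
  .seq (.instr (.const 7 0)) (.loop (.lt 7 5) (.seq dotCmd
    (block (.arith .mul 10 6 5) [.arith .add 10 10 7, .store 4 10 9, .arith .add 7 7 4])))

/-- The clause on `q < i * k` says that earlier rows survive; the loop over the points needs it. -/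
theorem total_rowCmd {n d ℓ k i : ℕ} {s : State} (hR : Regs n d ℓ k s) (h6 : s.int 6 = i) :
    Total rowCmd s (k * (18 * d + 14) + 3) fun s' =>
      (∀ x < 7, s'.int x = s.int x) ∧ (∀ A ≠ 4, s'.mem A = s.mem A) ∧
      (∀ q < i * k, s'.mem 4 (q : ℕ) = s.mem 4 (q : ℕ)) ∧
      ∀ t < k, s'.mem 4 (i * k + t : ℕ) = dot d s.mem i t := by
  let I : ℕ → State → Prop := fun t s' => (∀ x < 7, s'.int x = s.int x) ∧
    (∀ A ≠ 4, s'.mem A = s.mem A) ∧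
      (∀ q < i * k, s'.mem 4 (q : ℕ) = s.mem 4 (q : ℕ)) ∧
      (∀ t' < t, s'.mem 4 (i * k + t' : ℕ) = dot d s.mem i t') ∧ s'.int 7 = t
  refine Total.seq (Q₁ := I 0) (Total.block (l := []) ?_) (fun s₁ h₁ => Total.loop (N := k) I
    (B := 18 * d + 13) (fun t ht s' h => ⟨?_, ?_⟩) (fun s' h => ⟨?_, ?_⟩) h₁)
    (by change 2 * 0 + 1 + (k * (18 * d + 14) + 1) + 1 ≤ _; omega)
  · simp +contextual (disch := omega) [I, Instr.exec, Function.update_of_ne]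
  · rw [Test.Holds, h.2.2.2.2, h.1 5 (by omega), hR.k_eq]
    exact_mod_cast ht
  · obtain ⟨hx, hm, hq, h4, h7⟩ := h
    have hR' := hR.of_eq fun x h => hx x (by omega)
    have e6 := (hx 6 (by omega)).trans h6
    refine Total.seq (total_dotCmd hR' e6 h7) (fun s₂ h₂ => Total.block ?_) (by simp)
    obtain ⟨gx, gm, g9⟩ := h₂
    have f4 := (gx 4 (by omega)).trans hR'.one_eq
    have f5 := (gx 5 (by omega)).trans hR'.k_eq
    have f6 := (gx 6 (by omega)).trans e6
    have f7 := (gx 7 (by omega)).trans h7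
    have hdot : dot d s'.mem i t = dot d s.mem i t := by
      simp [dot, hm]
    refine ⟨fun x hx' => ?_, fun A hA => ?_, fun q hq' => ?_, fun t' ht' => ?_, ?_⟩
    · simp (disch := omega) [Instr.exec, Function.update_of_ne, gx x (by omega), hx x hx']
    · simp [Instr.exec, Function.update_of_ne hA, gm, hm A hA]
    · have : (q : ℤ) ≠ i * k + t := by
        exact_mod_cast (show q ≠ i * k + t by omega)
      simp [Instr.exec, Op.eval, f5, f6, f7, Function.update_of_ne this, gm, hq q hq']
    · rcases (Nat.lt_succ_iff.1 ht').eq_or_lt with rfl | hlt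
      · simp [Instr.exec, Op.eval, f5, f6, f7, g9, hdot]
      · have : (i * k + t' : ℤ) ≠ i * k + t := by omega
        have h4' := h4 t' hlt
        push_cast at h4'
        simp [Instr.exec, Op.eval, f5, f6, f7, Function.update_of_ne this, gm, h4']
    · simp [Instr.exec, Op.eval, f7, f4]
  · rw [Test.Holds, h.2.2.2.2, h.1 5 (by omega), hR.k_eq]
    exact lt_irrefl _
  · exact ⟨h.1, h.2.1, h.2.2.1, h.2.2.2.1⟩

/-- Fills array `4` with the projections of all points. -/
def projCmd : Cmd :=
  .seq (.instr (.const 6 0)) (.loop (.lt 6 0) (.seq rowCmd (.instr (.arith .add 6 6 4))))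

theorem total_projCmd {n d ℓ k : ℕ} {s : State} (hR : Regs n d ℓ k s) :
    Total projCmd s (n * (k * (18 * d + 14) + 6) + 3) fun s' =>
      Regs n d ℓ k s' ∧
      ∀ i < n, ∀ t < k, s'.mem 4 (i * k + t : ℕ) = dot d s.mem i t := by
  let I : ℕ → State → Prop := fun i s' => (∀ x < 6, s'.int x = s.int x) ∧
    (∀ A ≠ 4, s'.mem A = s.mem A) ∧
      (∀ i' < i, ∀ t < k, s'.mem 4 (i' * k + t : ℕ) = dot d s.mem i' t) ∧ s'.int 6 = i
  refine Total.seq (Q₁ := I 0) (Total.block (l := []) ?_) (fun s₁ h₁ => Total.loop (N := n) I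
    (B := k * (18 * d + 14) + 5) (fun i hi s' h => ⟨?_, ?_⟩) (fun s' h => ⟨?_, ?_⟩) h₁)
    (by change 2 * 0 + 1 + (n * (k * (18 * d + 14) + 6) + 1) + 1 ≤ _; omega)
  · simp +contextual (disch := omega) [I, Instr.exec, Function.update_of_ne]
  · rw [Test.Holds, h.2.2.2, h.1 0 (by omega), hR.n_eq]
    exact_mod_cast hi
  · obtain ⟨hx, hm, h4, h6⟩ := h
    have hR' := hR.of_eq hx
    refine Total.seq (total_rowCmd hR' h6) (fun s₂ h₂ => Total.block (l := []) ?_)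
      (by simp)
    obtain ⟨gx, gm, gq, g4⟩ := h₂
    have f4 := (gx 4 (by omega)).trans hR'.one_eq
    have f6 := (gx 6 (by omega)).trans h6
    refine ⟨fun x hx' => ?_, fun A hA => ?_, fun i' hi' t ht => ?_, ?_⟩
    · simp (disch := omega) [Instr.exec, Function.update_of_ne, gx x (by omega), hx x hx']
    · simp [Instr.exec, gm A hA, hm A hA]
    · rcases (Nat.lt_succ_iff.1 hi').eq_or_lt with rfl | hlt
      · have := g4 t ht
        simpa [Instr.exec, dot, hm] using this
      · have h1 : i' * k + t < i * k := by
          have := Nat.mul_le_mul_right k (Nat.succ_le_of_lt hlt)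
          rw [Nat.succ_mul] at this
          omega
        have := (gq _ h1).trans (h4 i' hlt t ht)
        simpa [Instr.exec] using this
    · simp [Instr.exec, Op.eval, f6, f4]
  · rw [Test.Holds, h.2.2.2, h.1 0 (by omega), hR.n_eq]
    exact lt_irrefl _
  · exact ⟨hR.of_eq h.1, h.2.2.1⟩

/-! ### The farthest-point traversal -/

/-- Puts the squared distance of the rows `cur` and `m` of array `4` into register `11`; here
`cur` and `m` are the registers `7` and `8`. -/
def distCmd : Cmd :=
  .seq (block (.const 10 0) [.const 11 0])
    (.loop (.lt 10 5) (block (.arith .mul 12 7 5) [.arith .add 12 12 10, .load 12 4 12,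
      .arith .mul 13 8 5, .arith .add 13 13 10, .load 13 4 13, .arith .sub 12 12 13,
      .arith .mul 12 12 12, .arith .add 11 11 12, .arith .add 10 10 4]))

/-- The squared distance of the rows `u` and `v` of the matrix `F` with `k` columns. -/
def rowDist (k : ℕ) (F : ℤ → ℤ) (u v : ℕ) : ℤ :=
  ∑ t ∈ range k, (F (u * k + t : ℕ) - F (v * k + t : ℕ)) ^ 2

theorem rowDist_nonneg (k : ℕ) (F : ℤ → ℤ) (u v : ℕ) : 0 ≤ rowDist k F u v :=
  Finset.sum_nonneg fun _ _ => sq_nonneg _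

theorem total_distCmd {n d ℓ k u v : ℕ} {s : State} (hR : Regs n d ℓ k s) (h7 : s.int 7 = u)
    (h8 : s.int 8 = v) : Total distCmd s (20 * k + 5) fun s' =>
      (∀ x < 10, s'.int x = s.int x) ∧ s'.mem = s.mem ∧
        s'.int 11 = rowDist k (s.mem 4) u v := by
  let I : ℕ → State → Prop := fun t s' => (∀ x < 10, s'.int x = s.int x) ∧ s'.mem = s.mem ∧
    s'.int 11 = ∑ t ∈ range t, (s.mem 4 (u * k + t : ℕ) - s.mem 4 (v * k + t : ℕ)) ^ 2 ∧
    s'.int 10 = t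
  refine Total.seq (Q₁ := I 0) (Total.block ?_) (fun s₁ h₁ => Total.loop (N := k) I
    (fun t ht s' h => ⟨?_, Total.block ?_⟩) (fun s' h => ⟨?_, ?_⟩) h₁) (by simp; omega)
  · simp +contextual (disch := omega) [I, Instr.exec, Function.update_of_ne]
  · rw [Test.Holds, h.2.2.2, h.1 5 (by omega), hR.k_eq]
    exact_mod_cast ht
  · obtain ⟨hx, hm, h11, h10⟩ := h
    have e4 := (hx 4 (by omega)).trans hR.one_eq
    have e5 := (hx 5 (by omega)).trans hR.k_eq
    have e7 := (hx 7 (by omega)).trans h7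
    have e8 := (hx 8 (by omega)).trans h8
    refine ⟨fun x hx' => ?_, ?_, ?_, ?_⟩
    · simp (disch := omega) [Instr.exec, Function.update_of_ne, hx x hx']
    · simp [Instr.exec, hm]
    · simp [Instr.exec, Op.eval, Finset.sum_range_succ, pow_two, h11, h10, hm, e4, e5, e7, e8]
    · simp [Instr.exec, Op.eval, h10, e4]
  · rw [Test.Holds, h.2.2.2, h.1 5 (by omega), hR.k_eq]
    exact lt_irrefl _
  · exact ⟨h.1, h.2.1, h.2.2.1⟩

/-- Computes the distance of the newest center `cur` to the point `m` and, if `cur` is the first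
center or closer than the previous ones, records it in array `5` and the number `j` of `cur` in
array `2`; here `j`, `cur` and `m` are the registers `6`, `7` and `8`. -/
def relaxCmd : Cmd :=
  .seq distCmd (.seq (.instr (.load 12 5 8))
    (.ite (.lt 6 4) (block (.store 5 8 11) [.store 2 8 6, .arith .add 8 8 4])
      (.ite (.lt 11 12) (block (.store 5 8 11) [.store 2 8 6, .arith .add 8 8 4])
        (.instr (.arith .add 8 8 4)))))

/-- The effect of `relaxCmd` on the entry `m` of the arrays `5` and `2`. -/
def Relaxed (j : ℕ) (w D A D' A' : ℤ) : Prop :=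
  (j = 0 ∨ w < D → D' = w ∧ A' = j) ∧ (j ≠ 0 → D ≤ w → D' = D ∧ A' = A)

/-- The arrays `2` and `5` initially hold arbitrary data. The first center therefore overwrites them
unconditionally, which is what the test `j < 1` is for. -/
theorem total_relaxCmd {n d ℓ k j u v : ℕ} {s : State} (hR : Regs n d ℓ k s) (h6 : s.int 6 = j)
    (h7 : s.int 7 = u) (h8 : s.int 8 = v) : Total relaxCmd s (20 * k + 15) fun s' =>
      (∀ x < 8, s'.int x = s.int x) ∧ s'.int 8 = (v + 1 : ℕ) ∧
      (∀ A, A ≠ 2 → A ≠ 5 → s'.mem A = s.mem A) ∧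
      (∀ q : ℤ, q ≠ v → s'.mem 2 q = s.mem 2 q ∧ s'.mem 5 q = s.mem 5 q) ∧
      Relaxed j (rowDist k (s.mem 4) u v) (s.mem 5 v) (s.mem 2 v) (s'.mem 5 v) (s'.mem 2 v) := by
  refine Total.seq (total_distCmd hR h7 h8) (fun s₁ h₁ => ?_) (B₂ := 9) (by omega)
  obtain ⟨hx, hm, h11⟩ := h₁
  have e4 := (hx 4 (by omega)).trans hR.one_eq
  have e6 := (hx 6 (by omega)).trans h6
  have e7 := (hx 7 (by omega)).trans h7
  have e8 := (hx 8 (by omega)).trans h8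
  refine Total.seq (Q₁ := fun s₂ => s₂ = (Instr.load 12 5 8).exec s₁)
    (Total.block (l := []) rfl) (fun s₂ h₂ => ?_) (B₂ := 7) (by simp)
  subst h₂
  have hset : (j = 0 ∨ rowDist k (s.mem 4) u v < s.mem 5 v) →
      Total (block (.store 5 8 11) [.store 2 8 6, .arith .add 8 8 4])
        ((Instr.load 12 5 8).exec s₁) 5 fun s' =>
      (∀ x < 8, s'.int x = s.int x) ∧ s'.int 8 = (v + 1 : ℕ) ∧
      (∀ A, A ≠ 2 → A ≠ 5 → s'.mem A = s.mem A) ∧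
      (∀ q : ℤ, q ≠ v → s'.mem 2 q = s.mem 2 q ∧ s'.mem 5 q = s.mem 5 q) ∧
      Relaxed j (rowDist k (s.mem 4) u v) (s.mem 5 v) (s.mem 2 v) (s'.mem 5 v) (s'.mem 2 v) := by
    refine fun hlt => Total.block ⟨fun x hx' => ?_, ?_, fun A h2 h5 => ?_, fun q hq => ?_,
      fun _ => ?_, fun h0 hle => ?_⟩
    · simp (disch := omega) [Instr.exec, Function.update_of_ne, hx x (by omega)]
    · simp [Instr.exec, Op.eval, e8, e4]
    · simp [Instr.exec, Function.update_of_ne h2, Function.update_of_ne h5, hm]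
    · simp [Instr.exec, Function.update_of_ne hq, hm, e8]
    · simp [Instr.exec, e8, h11, e6]
    · omega
  refine (Total.ite (fun hc => (hset ?_).mono (B' := 6) (by omega) fun _ h => h) fun hc =>
    Total.ite (B := 5) (fun hc' => hset ?_) fun hc' =>
      (Total.block (l := []) ?_).mono (by simp) fun _ h => h).mono le_rfl fun _ h => h
  · left
    have hc' : (j : ℤ) < 1 := by simpa [Test.Holds, Instr.exec, e6, e4] using hc
    omega
  · right
    simpa [Test.Holds, Instr.exec, h11, hm, e8] using hc'
  · have h0 : j ≠ 0 := by
      simpa [Test.Holds, Instr.exec, e6, e4, Nat.pos_iff_ne_zero, Nat.one_le_iff_ne_zero] using hc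
    have hle : s.mem 5 v ≤ rowDist k (s.mem 4) u v := by
      simpa [Test.Holds, Instr.exec, h11, hm, e8] using hc'
    refine ⟨fun x hx' => ?_, ?_, fun A h2 h5 => ?_, fun q hq => ?_, fun h => ?_, fun _ _ => ?_⟩
    · simp (disch := omega) [Instr.exec, Function.update_of_ne, hx x (by omega)]
    · simp [Instr.exec, Op.eval, e8, e4]
    · simp [Instr.exec, hm]
    · simp [Instr.exec, hm]
    · omega
    · simp [Instr.exec, hm]

theorem total_relaxLoop {n d ℓ k j u : ℕ} {s : State} (hR : Regs n d ℓ k s) (h6 : s.int 6 = j)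
    (h7 : s.int 7 = u) (h8 : s.int 8 = 0) :
    Total (.loop (.lt 8 0) relaxCmd) s (n * (20 * k + 16) + 1) fun s' =>
      (∀ x < 8, s'.int x = s.int x) ∧ (∀ A, A ≠ 2 → A ≠ 5 → s'.mem A = s.mem A) ∧
      ∀ v < n, Relaxed j (rowDist k (s.mem 4) u v) (s.mem 5 (v : ℕ)) (s.mem 2 (v : ℕ))
        (s'.mem 5 (v : ℕ)) (s'.mem 2 (v : ℕ)) := by
  refine Total.loop (N := n) (fun i s' => (∀ x < 8, s'.int x = s.int x) ∧ s'.int 8 = i ∧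
    (∀ A, A ≠ 2 → A ≠ 5 → s'.mem A = s.mem A) ∧
    (∀ v : ℕ, i ≤ v → s'.mem 2 v = s.mem 2 v ∧ s'.mem 5 v = s.mem 5 v) ∧
    ∀ v < i, Relaxed j (rowDist k (s.mem 4) u v) (s.mem 5 (v : ℕ)) (s.mem 2 (v : ℕ))
        (s'.mem 5 (v : ℕ)) (s'.mem 2 (v : ℕ)))
    (fun i hi s' h => ⟨?_, ?_⟩) (fun s' h => ⟨?_, h.1, h.2.2.1, h.2.2.2.2⟩) ?_
  · rw [Test.Holds, h.2.1, h.1 0 (by omega), hR.n_eq]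
    exact_mod_cast hi
  · obtain ⟨hx, h8', hm, hge, hlt⟩ := h
    refine (total_relaxCmd (hR.of_eq fun x h => hx x (by omega)) ((hx 6 (by omega)).trans h6)
      ((hx 7 (by omega)).trans h7) h8').mono le_rfl fun s₂ h₂ => ?_
    obtain ⟨gx, g8, gm, gq, gr⟩ := h₂
    refine ⟨fun x h => (gx x h).trans (hx x h), g8,
      fun A h2 h5 => (gm A h2 h5).trans (hm A h2 h5), fun v hv => ?_, fun v hv => ?_⟩
    · obtain ⟨q2, q5⟩ := gq v (by omega)
      obtain ⟨r2, r5⟩ := hge v (by omega)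
      exact ⟨q2.trans r2, q5.trans r5⟩
    · rcases (Nat.lt_succ_iff.1 hv).eq_or_lt with rfl | hlt'
      · rwa [(hge v le_rfl).1, (hge v le_rfl).2, hm 4 (by omega) (by omega)] at gr
      · obtain ⟨q2, q5⟩ := gq v (by omega)
        rw [q2, q5]
        exact hlt v hlt'
  · rw [Test.Holds, h.2.1, h.1 0 (by omega), hR.n_eq]
    exact lt_irrefl _
  · exact ⟨fun _ _ => rfl, h8, fun _ _ _ => rfl, fun _ _ => ⟨rfl, rfl⟩, fun _ h => by omega⟩

/-- Moves to register `7` the index of the largest of the entries of array `5` whose value exceeds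
register `9`. -/
def argmaxCmd : Cmd :=
  .loop (.lt 8 0) (.seq (.instr (.load 10 5 8)) (.seq
    (.ite (.lt 9 10) (block (.arith .add 9 10 3) [.arith .add 7 8 3]) (.instr (.const 10 0)))
      (.instr (.arith .add 8 8 4))))

/-- Starting from the value `-1` with a strict comparison, the scan never selects an entry `-1`, the
mark of a center. Register `7` holds a candidate only once register `9` differs from `-1`, which
`hpos` guarantees by the end. -/
theorem total_argmaxCmd {n d ℓ k : ℕ} {s : State} (hR : Regs n d ℓ k s) (h8 : s.int 8 = 0)
    (h9 : s.int 9 = -1) (hpos : ∃ v < n, 0 ≤ s.mem 5 (v : ℕ)) :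
    Total argmaxCmd s (n * 9 + 1) fun s' =>
      (∀ x < 7, s'.int x = s.int x) ∧ s'.mem = s.mem ∧
      ∃ c < n, s'.int 7 = (c : ℕ) ∧ 0 ≤ s.mem 5 (c : ℕ) ∧
        ∀ v < n, s.mem 5 (v : ℕ) ≤ s.mem 5 (c : ℕ) := by
  refine Total.loop (N := n) (fun i s' => (∀ x < 7, s'.int x = s.int x) ∧ s'.mem = s.mem ∧
    s'.int 8 = i ∧ -1 ≤ s'.int 9 ∧ (∀ v < i, s.mem 5 (v : ℕ) ≤ s'.int 9) ∧
    (s'.int 9 ≠ -1 → ∃ c < i, s'.int 7 = (c : ℕ) ∧ s.mem 5 (c : ℕ) = s'.int 9))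
    (fun i hi s' h => ⟨?_, ?_⟩) (fun s' h => ⟨?_, h.1, h.2.1, ?_⟩) ?_
  · rw [Test.Holds, h.2.2.1, h.1 0 (by omega), hR.n_eq]
    exact_mod_cast hi
  · obtain ⟨hx, hm, g8, g9, hle, hex⟩ := h
    have hR' := hR.of_eq fun x h => hx x (by omega)
    have e3 := hR'.zero_eq
    have e4 := hR'.one_eq
    refine Total.seq (B₁ := 1) (Q₁ := fun s₂ => s₂ = (Instr.load 10 5 8).exec s')
      (Total.block (l := []) rfl) (fun s₂ h₂ => ?_) (B₂ := 6) (by omega)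
    subst h₂
    refine Total.seq (Q₁ := fun s' => (∀ x < 7, s'.int x = s.int x) ∧ s'.mem = s.mem ∧
      s'.int 8 = i ∧ -1 ≤ s'.int 9 ∧ (∀ v < i + 1, s.mem 5 (v : ℕ) ≤ s'.int 9) ∧
      (s'.int 9 ≠ -1 → ∃ c < i + 1, s'.int 7 = (c : ℕ) ∧ s.mem 5 (c : ℕ) = s'.int 9))
      (Total.ite (B := 3) (fun hc => Total.block ?_) fun hc =>
        (Total.block (l := []) ?_).mono (by simp) fun _ h => h)
      (fun s₂ h₂ => Total.block (l := []) ?_) (by simp)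
    · have hc' : s'.int 9 < s.mem 5 i := by simpa [Test.Holds, Instr.exec, g8, hm] using hc
      refine ⟨fun x hx' => ?_, ?_, ?_, ?_, fun v hv => ?_, fun _ => ⟨i, by omega, ?_, ?_⟩⟩
      · simp (disch := omega) [Instr.exec, Function.update_of_ne, hx x (by omega)]
      · simp [Instr.exec, hm]
      · simp [Instr.exec, g8]
      · simp [Instr.exec, Op.eval, g8, hm, e3]
        omega
      · have : s.mem 5 (v : ℕ) ≤ s.mem 5 (i : ℕ) := by
          rcases (Nat.lt_succ_iff.1 hv).eq_or_lt with rfl | hlt'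
          · exact le_rfl
          · exact (hle v hlt').trans hc'.le
        simpa [Instr.exec, Op.eval, g8, hm, e3] using this
      · simp [Instr.exec, Op.eval, g8, e3]
      · simp [Instr.exec, Op.eval, g8, hm, e3]
    · have hc' : s.mem 5 i ≤ s'.int 9 := by simpa [Test.Holds, Instr.exec, g8, hm] using hc
      refine ⟨fun x hx' => ?_, ?_, ?_, ?_, fun v hv => ?_, fun h => ?_⟩
      · simp (disch := omega) [Instr.exec, Function.update_of_ne, hx x (by omega)]
      · simp [Instr.exec, hm]
      · simp [Instr.exec, g8]
      · simpa [Instr.exec] using g9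
      · have : s.mem 5 (v : ℕ) ≤ s'.int 9 := by
          rcases (Nat.lt_succ_iff.1 hv).eq_or_lt with rfl | hlt'
          · exact hc'
          · exact hle v hlt'
        simpa [Instr.exec] using this
      · obtain ⟨c, hc, h⟩ := hex (by simpa [Instr.exec] using h)
        exact ⟨c, by omega, by simpa [Instr.exec] using h⟩
    · obtain ⟨gx, gm, g8', g9', gle, gex⟩ := h₂
      have f4 := (gx 4 (by omega)).trans hR.one_eq
      refine ⟨fun x hx' => ?_, ?_, ?_, ?_, fun v hv => ?_, fun h => ?_⟩
      · simp (disch := omega) [Instr.exec, Function.update_of_ne, gx x (by omega)]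
      · simp [Instr.exec, gm]
      · simp [Instr.exec, Op.eval, g8', f4]
      · simpa [Instr.exec] using g9'
      · simpa [Instr.exec] using gle v hv
      · simpa [Instr.exec] using gex (by simpa [Instr.exec] using h)
  · rw [Test.Holds, h.2.2.1, h.1 0 (by omega), hR.n_eq]
    exact lt_irrefl _
  · exact ⟨fun _ _ => rfl, rfl, h8, h9.ge, fun _ h => by omega, fun h => absurd h9 h⟩
  · obtain ⟨hx, hm, g8, g9, hle, hex⟩ := h
    obtain ⟨v, hv, h0⟩ := hpos
    have := hle v hv
    obtain ⟨c, hc, h7, hc9⟩ := hex (by omega)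
    exact ⟨c, hc, h7, by omega, fun v hv => hc9 ▸ hle v hv⟩

/-! ### Invariants of the traversal, independent of the machine -/

/-- `T 0, …, T j` are the first centers of a farthest-point traversal of `0, …, n - 1`. -/
structure Greedy (n : ℕ) (W : ℕ → ℕ → ℤ) (j : ℕ) (T : ℕ → ℕ) : Prop where
  lt : ∀ i ≤ j, T i < n
  zero : T 0 = 0
  fresh : ∀ i i', i < i' → i' ≤ j → T i ≠ T i'
  farthest : ∀ j', j' ≤ j → ∀ v < n, (∀ i < j', T i ≠ v) →
    ∀ i' < j', ∃ i < j', W (T i) v ≤ W (T i') (T j')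

/-- `A v` is the number of a center that is closest to `v` among `T 0, …, T (j-1)`, and `D v` is
its distance, or `-1` if `v` itself is a center. -/
def Recorded (n : ℕ) (W : ℕ → ℕ → ℤ) (j : ℕ) (T : ℕ → ℕ) (D A : ℕ → ℤ) : Prop :=
  ∀ v < n, ∃ b < j, A v = b ∧ ((T b = v ∧ D v = -1) ∨
    ((∀ i < j, T i ≠ v) ∧ D v = W (T b) v ∧ ∀ i < j, W (T b) v ≤ W (T i) v))

theorem Recorded.congr {n j : ℕ} {W : ℕ → ℕ → ℤ} {T T' : ℕ → ℕ} {D A : ℕ → ℤ}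
    (h : Recorded n W j T D A) (hT : ∀ i < j, T' i = T i) : Recorded n W j T' D A := by
  intro v hv
  obtain ⟨b, hb, hA, h⟩ := h v hv
  refine ⟨b, hb, hA, ?_⟩
  rw [hT b hb]
  refine h.imp_right fun ⟨h1, h2, h3⟩ => ⟨fun i hi => ?_, h2, fun i hi => ?_⟩ <;> rw [hT i hi]
  exacts [h1 i hi, h3 i hi]

/-- The strict comparison with the new distance retains the older center on ties. The new center
itself is marked separately, by `hcur`. -/
theorem Recorded.step {n j : ℕ} {W : ℕ → ℕ → ℤ} {T : ℕ → ℕ} {D A D' A' : ℕ → ℤ}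
    (hW : ∀ u v, 0 ≤ W u v) (h : 0 < j → Recorded n W j T D A)
    (hcur : D' (T j) = -1 ∧ A' (T j) = j)
    (hrel : ∀ v < n, v ≠ T j → Relaxed j (W (T j) v) (D v) (A v) (D' v) (A' v)) :
    Recorded n W (j + 1) T D' A' := by
  intro v hv
  by_cases hvj : v = T j
  · subst hvj
    exact ⟨j, by omega, hcur.2, Or.inl ⟨rfl, hcur.1⟩⟩
  obtain ⟨h1, h2⟩ := hrel v hv hvj
  rcases Nat.eq_zero_or_pos j with rfl | hj
  · obtain ⟨e1, e2⟩ := h1 (Or.inl rfl)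
    refine ⟨0, by omega, e2, Or.inr ⟨fun i hi => ?_, e1, fun i hi => ?_⟩⟩ <;>
      obtain rfl : i = 0 := by omega
    exacts [fun h => hvj h.symm, le_rfl]
  obtain ⟨b, hb, hA, hD⟩ := h hj v hv
  rcases hD with ⟨hbv, hD⟩ | ⟨hf, hD, hmin⟩
  · obtain ⟨e1, e2⟩ := h2 hj.ne' (by linarith [hW (T j) v])
    exact ⟨b, by omega, e2.trans hA, Or.inl ⟨hbv, e1.trans hD⟩⟩
  · have hf' : ∀ i < j + 1, T i ≠ v := fun i hi => by
      rcases (Nat.lt_succ_iff.1 hi).eq_or_lt with rfl | hlt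
      · exact fun h => hvj h.symm
      · exact hf i hlt
    rcases lt_or_ge (W (T j) v) (D v) with hlt | hge
    · obtain ⟨e1, e2⟩ := h1 (Or.inr hlt)
      refine ⟨j, by omega, e2, Or.inr ⟨hf', e1, fun i hi => ?_⟩⟩
      rcases (Nat.lt_succ_iff.1 hi).eq_or_lt with rfl | hij
      · exact le_rfl
      · linarith [hmin i hij]
    · obtain ⟨e1, e2⟩ := h2 hj.ne' hge
      refine ⟨b, by omega, e2.trans hA, Or.inr ⟨hf', e1.trans hD, fun i hi => ?_⟩⟩
      rcases (Nat.lt_succ_iff.1 hi).eq_or_lt with rfl | hij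
      · linarith
      · exact hmin i hij

/-- Fewer than `n` centers leave some point uncovered, and its entry is a genuine distance. -/
theorem Recorded.exists_nonneg {n j : ℕ} {W : ℕ → ℕ → ℤ} {T : ℕ → ℕ} {D A : ℕ → ℤ}
    (hW : ∀ u v, 0 ≤ W u v) (h : Recorded n W j T D A) (hj : j < n) : ∃ v < n, 0 ≤ D v := by
  obtain ⟨v, hv, hvT⟩ := Finset.exists_mem_notMem_of_card_lt_card
    (s := (range j).image T) (t := range n)
    (Finset.card_image_le.trans_lt (by simpa using hj))
  have hv' := Finset.mem_range.1 hv
  obtain ⟨b, hb, -, ⟨hbv, -⟩ | ⟨-, hD, -⟩⟩ := h v hv'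
  · exact absurd (Finset.mem_image.2 ⟨b, Finset.mem_range.2 hb, hbv⟩) hvT
  · exact ⟨v, hv', hD ▸ hW _ _⟩

/-- A nonnegative entry belongs to a point that is not a center and equals its distance to the
closest center. Maximizing the entries is thus exactly the greedy rule. -/
theorem Greedy.step {n j c : ℕ} {W : ℕ → ℕ → ℤ} {T : ℕ → ℕ} {D A : ℕ → ℤ} (hG : Greedy n W j T)
    (h : Recorded n W (j + 1) T D A) (hc : c < n) (hc0 : 0 ≤ D c) (hmax : ∀ v < n, D v ≤ D c) :
    Greedy n W (j + 1) (Function.update T (j + 1) c) := by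
  have hT : ∀ i < j + 1, Function.update T (j + 1) c i = T i := fun i hi =>
    Function.update_of_ne (by omega) _ _
  obtain ⟨b, hb, -, ⟨-, hD⟩ | ⟨hf, hD, hmin⟩⟩ := h c hc
  · omega
  refine ⟨fun i hi => ?_, ?_, fun i i' hii hi' => ?_, fun j' hj' v hv hvT i' hi' => ?_⟩
  · rcases hi.eq_or_lt with rfl | hlt
    · rwa [Function.update_self]
    · rw [hT i hlt]
      exact hG.lt i (by omega)
  · rw [hT 0 (by omega), hG.zero]
  · rw [hT i (by omega)]
    rcases hi'.eq_or_lt with rfl | hlt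
    · rw [Function.update_self]
      exact hf i hii
    · rw [hT i' hlt]
      exact hG.fresh i i' hii (by omega)
  · have hvT' : ∀ i < j', T i ≠ v := fun i hi => hT i (by omega) ▸ hvT i hi
    rw [hT i' (by omega)]
    rcases hj'.eq_or_lt with rfl | hlt
    · rw [Function.update_self]
      obtain ⟨b', hb', -, ⟨hbv, -⟩ | ⟨-, hD', -⟩⟩ := h v hv
      · exact absurd hbv (hvT' b' hb')
      · refine ⟨b', hb', ?_⟩
        rw [hT b' hb', ← hD']
        exact (hmax v hv).trans (hD.trans_le (hmin i' hi'))
    · obtain ⟨i, hi, hle⟩ := hG.farthest j' (by omega) v hv hvT' i' hi'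
      refine ⟨i, hi, ?_⟩
      rwa [hT i (by omega), hT j' hlt]

/-- One round of the traversal; `j` and `cur` are the registers `6` and `7`. -/
def roundCmd : Cmd :=
  .seq (.instr (.const 8 0)) (.seq (.loop (.lt 8 0) relaxCmd) (.seq
    (block (.const 9 (-1)) [.store 5 7 9, .store 2 7 6, .store 1 6 7, .const 8 0,
      .arith .add 6 6 4]) argmaxCmd))

/-- The entries of the current center are set after the relaxation. The mark `-1`, in place of the
distance `0`, prevents choosing it again even if all remaining distances are `0`; the number `j`
keeps it in its own cluster even if it coincides with an earlier center. -/
theorem total_roundCmd {n d ℓ k j : ℕ} {s : State} {T : ℕ → ℕ} (hR : Regs n d ℓ k s)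
    (h6 : s.int 6 = j) (h7 : s.int 7 = T j) (hjn : j + 1 < n)
    (hG : Greedy n (rowDist k (s.mem 4)) j T)
    (hrec : 0 < j → Recorded n (rowDist k (s.mem 4)) j T (fun v => s.mem 5 v) fun v => s.mem 2 v) :
    Total roundCmd s (n * (20 * k + 25) + 17) fun s' =>
      Regs n d ℓ k s' ∧ s'.int 6 = (j + 1 : ℕ) ∧ s'.mem 4 = s.mem 4 ∧
      s'.mem 1 = Function.update (s.mem 1) j (T j) ∧ ∃ c : ℕ, s'.int 7 = c ∧
        Greedy n (rowDist k (s.mem 4)) (j + 1) (Function.update T (j + 1) c) ∧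
        Recorded n (rowDist k (s.mem 4)) (j + 1) T (fun v => s'.mem 5 v) fun v => s'.mem 2 v := by
  have hT := hG.lt j le_rfl
  refine Total.seq (Q₁ := fun s₁ => s₁ = (Instr.const 8 0).exec s) (Total.block (l := []) rfl)
    (fun s₁ h₁ => ?_) (B₂ := n * (20 * k + 25) + 15) (by simp; omega)
  subst h₁
  refine Total.seq (total_relaxLoop (j := j) (u := T j) (hR.of_eq fun x hx => ?_)
    (by simpa [Instr.exec] using h6) (by simpa [Instr.exec] using h7) (by simp [Instr.exec]))
    (fun s₂ h₂ => ?_) (B₂ := n * 9 + 13) ?_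
  · simp (disch := omega) [Instr.exec, Function.update_of_ne]
  · obtain ⟨gx, gm, gr⟩ := h₂
    have gx' : ∀ x < 8, s₂.int x = s.int x := fun x hx => by
      rw [gx x hx]
      simp (disch := omega) [Instr.exec, Function.update_of_ne]
    replace gm : ∀ A, A ≠ 2 → A ≠ 5 → s₂.mem A = s.mem A := fun A h2 h5 => by
      rw [gm A h2 h5]
      rfl
    replace gr : ∀ v < n, Relaxed j (rowDist k (s.mem 4) (T j) v) (s.mem 5 (v : ℕ))
      (s.mem 2 (v : ℕ)) (s₂.mem 5 (v : ℕ)) (s₂.mem 2 (v : ℕ)) := gr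
    have e4 := (gx' 4 (by omega)).trans hR.one_eq
    have e6 := (gx' 6 (by omega)).trans h6
    have e7 := (gx' 7 (by omega)).trans h7
    refine Total.seq (Q₁ := fun s₃ => (∀ x < 6, s₃.int x = s.int x) ∧ s₃.int 6 = (j + 1 : ℕ) ∧
      s₃.int 8 = 0 ∧ s₃.int 9 = -1 ∧ s₃.mem 4 = s.mem 4 ∧
      s₃.mem 1 = Function.update (s.mem 1) j (T j) ∧
      s₃.mem 2 = Function.update (s₂.mem 2) (T j) j ∧
      s₃.mem 5 = Function.update (s₂.mem 5) (T j) (-1)) (Total.block ?_) (fun s₃ h₃ => ?_)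
      (B₂ := n * 9 + 1) (by simp; omega)
    · refine ⟨fun x hx => ?_, ?_, ?_, ?_, ?_, ?_, ?_, ?_⟩
      · simp (disch := omega) [Instr.exec, Function.update_of_ne, gx' x (by omega)]
      all_goals simp [Instr.exec, Op.eval, e4, e6, e7, gm]
    · obtain ⟨fx, f6, f8, f9, m4, m1, m2, m5⟩ := h₃
      have hR₃ := hR.of_eq fx
      have hnew : Recorded n (rowDist k (s.mem 4)) (j + 1) T (fun v => s₃.mem 5 v)
          fun v => s₃.mem 2 v := by
        refine Recorded.step (rowDist_nonneg _ _) hrec ?_ fun v hv hne => ?_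
        · simp [m2, m5]
        · have : (v : ℤ) ≠ T j := by exact_mod_cast hne
          simpa [m2, m5, Function.update_of_ne this] using gr v hv
      refine (total_argmaxCmd hR₃ f8 f9 (hnew.exists_nonneg (rowDist_nonneg _ _) hjn)).mono
        le_rfl fun s₄ h₄ => ?_
      obtain ⟨kx, km, c, hc, k7, hc0, hmax⟩ := h₄
      refine ⟨hR₃.of_eq fun x hx => kx x (by omega), (kx 6 (by omega)).trans f6, ?_, ?_, c, k7,
        hG.step hnew hc hc0 hmax, ?_⟩
      · rw [km, m4]
      · rw [km, m1]
      · rw [km]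
        exact hnew
  · have : n * (20 * k + 25) = n * (20 * k + 16) + n * 9 := by ring
    omega

/-- The farthest-point traversal of the rows of array `4`. -/
def traversalCmd : Cmd :=
  .seq (block (.const 6 0) [.const 7 0]) (.loop (.lt 6 2) roundCmd)

/-- Each round already selects the next center, so one more than needed is found. Its existence
after the last round uses `ℓ < n`. -/
theorem total_traversalCmd {n d ℓ k : ℕ} {s : State} (hR : Regs n d ℓ k s) (hℓ : 1 ≤ ℓ)
    (hℓn : ℓ < n) :
    Total traversalCmd s (ℓ * (n * (20 * k + 25) + 18) + 5) fun s' => ∃ T : ℕ → ℕ,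
      Greedy n (rowDist k (s.mem 4)) ℓ T ∧ (∀ i < ℓ, s'.mem 1 (i : ℕ) = T i) ∧
      Recorded n (rowDist k (s.mem 4)) ℓ T (fun v => s'.mem 5 v) fun v => s'.mem 2 v := by
  let I : ℕ → State → Prop := fun j s' => Regs n d ℓ k s' ∧ s'.int 6 = j ∧
    s'.mem 4 = s.mem 4 ∧ ∃ T : ℕ → ℕ, s'.int 7 = T j ∧ Greedy n (rowDist k (s.mem 4)) j T ∧
      (∀ i < j, s'.mem 1 (i : ℕ) = T i) ∧ (0 < j →
        Recorded n (rowDist k (s.mem 4)) j T (fun v => s'.mem 5 v) fun v => s'.mem 2 v)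
  refine Total.seq (Q₁ := I 0) (Total.block ?_) (fun s₁ h₁ => Total.loop (N := ℓ) I
    (B := n * (20 * k + 25) + 17) (fun j hj s' h => ⟨?_, ?_⟩) (fun s' h => ⟨?_, ?_⟩) h₁)
    (by change 2 * 1 + 1 + (ℓ * (n * (20 * k + 25) + 18) + 1) + 1 ≤ _; omega)
  · refine ⟨hR.of_eq fun x hx => ?_, ?_, ?_, fun _ => 0, ?_, ⟨fun _ _ => by omega, rfl,
      fun _ _ _ _ => by omega, fun _ _ _ _ _ _ _ => by omega⟩, fun _ _ => by omega,
      fun h => absurd h (lt_irrefl 0)⟩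
    · simp (disch := omega) [Instr.exec, Function.update_of_ne]
    all_goals simp [Instr.exec]
  · rw [Test.Holds, h.2.1, h.1.l_eq]
    exact_mod_cast hj
  · obtain ⟨hR', h6, h4, T, h7, hG, h1, hrec⟩ := h
    refine (total_roundCmd hR' h6 h7 (by omega) (h4 ▸ hG) (h4 ▸ hrec)).mono le_rfl
      fun s₂ h₂ => ?_
    obtain ⟨gR, g6, g4, g1, c, g7, gG, grec⟩ := h₂
    rw [h4] at g4 gG grec
    refine ⟨gR, g6, g4, Function.update T (j + 1) c, by simpa using g7, gG, fun i hi => ?_,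
      fun _ => grec.congr fun i hi => Function.update_of_ne (by omega) _ _⟩
    rw [g1, Function.update_of_ne (by omega : i ≠ j + 1)]
    rcases (Nat.lt_succ_iff.1 hi).eq_or_lt with rfl | hlt
    · simp
    · rw [Function.update_of_ne (by omega : (i : ℤ) ≠ j)]
      exact h1 i hlt
  · rw [Test.Holds, h.2.1, h.1.l_eq]
    exact lt_irrefl _
  · obtain ⟨hR', h6, h4, T, h7, hG, h1, hrec⟩ := h
    exact ⟨T, hG, h1, hrec (by omega)⟩

/-! ### The whole program -/

/-- The procedure and its modification: the centers are left in array `1`, the clusters in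
array `2`. -/
def clusterCmd (c : ℕ) : Cmd :=
  .seq (dimCmd c) (.seq matrixCmd (.seq projCmd traversalCmd))

theorem dot_eq_proj {n d k : ℕ} {p : Fin n → Fin d → Bool} {ω : ℕ → Bool} {M : ℕ → ℤ → ℤ}
    (hP : ∀ (i : Fin n) (j : Fin d), M 0 ((i.val * d + j.val : ℕ) : ℤ) = if p i j then 1 else 0)
    (hM : ∀ q < k * d, M 3 (q : ℕ) = boolSign (ω q)) (i : Fin n) (t : Fin k) :
    dot d M i t = proj (signMatrix k d ω) (p i) t := by
  rw [dot, proj, Matrix.mulVec, dotProduct, ← Fin.sum_univ_eq_sum_range (fun j =>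
    M 3 (t * d + j : ℕ) * M 0 (i * d + j : ℕ))]
  refine Finset.sum_congr rfl fun j _ => ?_
  have : t * d + j < k * d := by
    have := Nat.mul_le_mul_right d (Nat.succ_le_of_lt t.2)
    rw [Nat.succ_mul] at this
    omega
  rw [hP i j, hM _ this]
  rfl

theorem rowDist_eq_sqDist {n d k : ℕ} {p : Fin n → Fin d → Bool} {R : Matrix (Fin k) (Fin d) ℤ}
    {F : ℤ → ℤ} (hF : ∀ (i : Fin n) (t : Fin k), F (i * k + t : ℕ) = proj R (p i) t)
    (u v : Fin n) : rowDist k F u v = sqDist R p u v := by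
  rw [rowDist, sqDist, ← Fin.sum_univ_eq_sum_range (fun t =>
    (F (u * k + t : ℕ) - F (v * k + t : ℕ)) ^ 2)]
  exact Finset.sum_congr rfl fun t _ => by rw [hF, hF]

/-- The `∀ i', ∃ i` form in `Greedy` is the comparison of two minima over nonempty finite sets. -/
theorem Greedy.isTraversal {n ℓ : ℕ} {W : ℕ → ℕ → ℤ} {W' : Fin n → Fin n → ℤ} {T : ℕ → ℕ}
    (hG : Greedy n W ℓ T) (hW : ∀ u v : Fin n, W u v = W' u v) :
    IsTraversal W' fun i : Fin ℓ => ⟨T i, hG.lt i i.2.le⟩ where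
  first j hj := by simpa [hj] using hG.zero
  fresh i j hij h := hG.fresh i j hij j.2.le (Fin.mk.inj_iff.1 h)
  farthest j hj m hm := by
    have : Nonempty (Set.Iio j) := ⟨⟨⟨0, by omega⟩, Fin.lt_def.2 hj⟩⟩
    refine le_ciInf fun i' => ?_
    obtain ⟨i, hi, hle⟩ := hG.farthest j j.2.le m m.2
      (fun i hi h => hm ⟨i, by omega⟩ (Fin.lt_def.2 hi) (Fin.ext h)) i'.1 (Fin.lt_def.1 i'.2)
    refine (ciInf_le (Set.finite_range _).bddBelow
      (⟨⟨i, by omega⟩, Fin.lt_def.2 hi⟩ : Set.Iio j)).trans ?_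
    rw [← hW, ← hW]
    exact hle

theorem total_clusterCmd {n d ℓ c : ℕ} {p : Fin n → Fin d → Bool} {δ : ℝ} {ω : ℕ → Bool}
    {s : State} (hs : Encodes p ℓ δ ω s) (hδ : 0 < δ) (hℓ : 1 ≤ ℓ) (hℓn : ℓ < n) :
    Total (clusterCmd c) s (4 * Nat.clog 2 n + 4 * projDim c n δ + 10 * (projDim c n δ * d) +
      n * (projDim c n δ * (18 * d + 14) + 6) + ℓ * (n * (20 * projDim c n δ + 25) + 18) + 39)
      fun s' => ∃ (T : Fin ℓ → Fin n) (a : Fin n → Fin ℓ), Holds s' 1 T ∧ Holds s' 2 a ∧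
        DimRedHamCenter c p δ ω T ∧ (∀ i, a (T i) = i) ∧
        ∀ v i, sqDist (signMatrix (projDim c n δ) d ω) p (T (a v)) v ≤
          sqDist (signMatrix (projDim c n δ) d ω) p (T i) v := by
  refine Total.seq (total_dimCmd hs.n_eq hs.d_eq hs.l_eq hs.δ_eq hδ) (fun s₁ h₁ => Total.seq
    (total_matrixCmd h₁.1) (fun s₂ h₂ => Total.seq (total_projCmd h₂.1) (fun s₃ h₃ =>
      (total_traversalCmd h₃.1 hℓ hℓn).mono le_rfl fun s₄ h₄ => ?_) le_rfl) le_rfl) (by omega)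
  obtain ⟨-, hm₁, hc₁⟩ := h₁
  obtain ⟨-, hm₂, h3⟩ := h₂
  obtain ⟨-, h4⟩ := h₃
  obtain ⟨T, hG, hT, hrec⟩ := h₄
  set k := projDim c n δ
  rw [hc₁, hs.coins_eq] at h3
  have hP : ∀ (i : Fin n) (j : Fin d),
      s₂.mem 0 ((i.val * d + j.val : ℕ) : ℤ) = if p i j then 1 else 0 := fun i j => by
    rw [hm₂ 0 (by omega), hm₁, hs.points]
  have hF : ∀ (i : Fin n) (t : Fin k),
      s₃.mem 4 (i * k + t : ℕ) = proj (signMatrix k d ω) (p i) t := fun i t =>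
    (h4 i i.2 t t.2).trans (dot_eq_proj hP h3 i t)
  have hW := rowDist_eq_sqDist hF
  choose a ha haA hD using hrec
  refine ⟨fun i => ⟨T i, hG.lt i i.2.le⟩, fun v => ⟨a v v.2, ha v v.2⟩, fun i => hT i i.2,
    fun v => haA v v.2, hG.isTraversal hW, fun i => ?_, fun v i => ?_⟩
  · refine Fin.ext ?_
    -- A center is recorded under some index with the same point; distinctness of the centers makes
    -- that index `i`.
    rcases hD (T i) (hG.lt i i.2.le) with ⟨h, -⟩ | ⟨h, -⟩
    · by_contra hne
      rcases lt_or_gt_of_ne hne with hlt | hlt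
      · exact hG.fresh _ _ hlt i.2.le h
      · exact hG.fresh _ _ hlt (ha _ _).le h.symm
    · exact absurd rfl (h i i.2)
  · rw [← hW, ← hW]
    rcases hD v v.2 with ⟨h, -⟩ | ⟨-, -, h⟩
    · have : rowDist k (s₃.mem 4) (T (a v v.2)) v = 0 := by
        rw [h]
        simp [rowDist]
      exact this.le.trans (rowDist_nonneg _ _ _ _)
    · exact h i i.2

end RAM

/-! ### The running time -/

/-- Rounding up adds less than `1`, and `log n + log 2 ≤ 2 * log n`; finally `2 / log 2 < 3`. -/
theorem clog_le_log {n : ℕ} (hn : 2 ≤ n) : (Nat.clog 2 n : ℝ) ≤ 3 * Real.log n := by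
  have hn' : (2 : ℝ) ≤ n := by exact_mod_cast hn
  have h1 : (2 : ℝ) ^ (Nat.clog 2 n - 1) ≤ n := by
    exact_mod_cast (Nat.pow_pred_clog_lt_self one_lt_two hn).le
  have h2 := Real.log_le_log (by positivity) h1
  have h3 := Real.log_le_log (by norm_num) hn'
  rw [Real.log_pow, Nat.cast_sub (Nat.clog_pos one_lt_two hn), Nat.cast_one] at h2
  have h4 := Real.log_two_gt_d9
  nlinarith [(Nat.cast_nonneg (Nat.clog 2 n) : (0 : ℝ) ≤ _)]

/-- With `X = c * Nat.clog 2 n / ε ^ 2 ≥ 1`, the ceiling is at most `25 * X + 1 ≤ 26 * X`; the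
factor `3` of `clog_le_log` makes `78`. -/
theorem projDim_le {n c : ℕ} {ε : ℝ} (hn : 2 ≤ n) (hc : 1 ≤ c) (hε : 0 < ε) (hε1 : ε < 1 / 2) :
    (projDim c n (ε / 5) : ℝ) ≤ 78 * c * Real.log n / ε ^ 2 := by
  have hc' : (1 : ℝ) ≤ c := by exact_mod_cast hc
  have hL : (1 : ℝ) ≤ Nat.clog 2 n := by exact_mod_cast Nat.clog_pos one_lt_two hn
  have h1 := (Nat.ceil_lt_add_one
    (by positivity : 0 ≤ (c : ℝ) * (Nat.clog 2 n : ℝ) / (ε / 5) ^ 2)).le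
  have h2 : (1 : ℝ) ≤ c * Nat.clog 2 n / ε ^ 2 := by
    rw [le_div_iff₀ (by positivity)]
    nlinarith
  have h3 : (c : ℝ) * (Nat.clog 2 n : ℝ) / (ε / 5) ^ 2 = 25 * (c * Nat.clog 2 n / ε ^ 2) := by
    field_simp
    norm_num
  rw [h3] at h1
  have h4 : (c : ℝ) * Nat.clog 2 n / ε ^ 2 ≤ c * (3 * Real.log n) / ε ^ 2 := by
    gcongr
    exact clog_le_log hn
  have h5 : 78 * c * Real.log n / ε ^ 2 = 26 * (c * (3 * Real.log n) / ε ^ 2) := by ring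
  rw [h5, projDim, h3]
  linarith

/-- Since `n`, `ℓ` and `k` are positive, each summand is at most a constant times `n * k * d` or `n
* k * ℓ`. -/
theorem time_le {n d ℓ k L : ℕ} (hn : 1 ≤ n) (hℓ : 1 ≤ ℓ) (hk : 1 ≤ k) (hL : L ≤ k) :
    4 * L + 4 * k + 10 * (k * d) + n * (k * (18 * d + 14) + 6) +
      ℓ * (n * (20 * k + 25) + 18) + 39 ≤ 200 * (n * k * (d + ℓ)) := by
  have h1 : k * d ≤ n * (k * d) := Nat.le_mul_of_pos_left _ hn
  have h2 : n * k ≤ n * k * ℓ := Nat.le_mul_of_pos_right _ hℓ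
  have h3 : n ≤ n * k := Nat.le_mul_of_pos_right _ hk
  have h4 : k ≤ n * k := Nat.le_mul_of_pos_left _ hn
  have h5 : n * ℓ ≤ n * ℓ * k := Nat.le_mul_of_pos_right _ hk
  have h6 : ℓ ≤ n * ℓ := Nat.le_mul_of_pos_left _ hn
  nlinarith

theorem clog_le_projDim {n c : ℕ} {δ : ℝ} (hc : 1 ≤ c) (hδ : 0 < δ) (hδ1 : δ ≤ 1) :
    Nat.clog 2 n ≤ projDim c n δ := by
  have hc' : (1 : ℝ) ≤ c := by exact_mod_cast hc
  have h1 := mul_clog_le_projDim (c := c) (n := n) hδ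
  have h2 : (projDim c n δ : ℝ) * δ ^ 2 ≤ projDim c n δ * 1 := by
    gcongr
    exact pow_le_one₀ hδ.le hδ1
  have h3 : (1 : ℝ) * Nat.clog 2 n ≤ c * Nat.clog 2 n := by gcongr
  have : (Nat.clog 2 n : ℝ) ≤ projDim c n δ := by linarith
  exact_mod_cast this

theorem RAM.exists_haltsWithin_clusterCmd {n d ℓ c : ℕ} {p : Fin n → Fin d → Bool} {ε : ℝ}
    {ω : ℕ → Bool} {s : RAM.State} (hs : RAM.Encodes p ℓ (ε / 5) ω s) (hc : 1 ≤ c) (hε : 0 < ε)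
    (hε1 : ε < 1 / 2) (hℓ : 1 ≤ ℓ) (hℓn : ℓ < n) :
    ∃ (s' : RAM.State) (T : Fin ℓ → Fin n) (a : Fin n → Fin ℓ),
      RAM.HaltsWithin (RAM.clusterCmd c) s
        (15600 * c * (n * Real.log n * ((d : ℝ) + ℓ) / ε ^ 2)) s' ∧
      RAM.Holds s' 1 T ∧ RAM.Holds s' 2 a ∧ DimRedHamCenter c p (ε / 5) ω T ∧
      DimRedHamCluster c p (ε / 5) ω a := by
  have hn : 2 ≤ n := by omega
  obtain ⟨s', hh, T, a, h1, h2, hT, ha⟩ :=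
    (RAM.total_clusterCmd hs (by positivity) hℓ hℓn (c := c)).haltsWithin
      (B' := 15600 * c * (n * Real.log n * ((d : ℝ) + ℓ) / ε ^ 2)) (by
      have h := time_le (d := d) (by omega : 1 ≤ n) hℓ
        (projDim_pos (by positivity : 0 < ε / 5) hn hc)
        (clog_le_projDim (n := n) hc (by positivity : 0 < ε / 5) (by linarith))
      refine (Nat.cast_le.2 h).trans ?_
      push_cast
      calc (200 : ℝ) * (n * projDim c n (ε / 5) * (d + ℓ))
          ≤ 200 * (n * (78 * c * Real.log n / ε ^ 2) * (d + ℓ)) := by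
            gcongr
            exact projDim_le hn hc hε hε1
        _ = _ := by ring)
  exact ⟨s', T, a, hh, h1, h2, hT, T, hT, ha⟩

theorem mainTheorem2 (α : ℝ) (hα : 1 ≤ α) :
    ∃ c₀ : ℕ, ∀ c : ℕ, c₀ ≤ c →
      ∃ (progCenter progCluster : RAM.Cmd) (C : ℝ),
        ∀ (n d ℓ : ℕ) (p : Fin n → Fin d → Bool) (ε : ℝ),
          1 ≤ ℓ → ℓ < n → 0 < ε → ε < 1 / 2 →
          -- the procedure can be implemented in the claimed time
          (∀ (ω : ℕ → Bool) (s : RAM.State), RAM.Encodes p ℓ (ε / 5) ω s →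
            ∃ (s' : RAM.State) (T : Fin ℓ → Fin n),
              RAM.HaltsWithin progCenter s
                (C * (n * Real.log n * ((d : ℝ) + ℓ) / ε ^ 2)) s' ∧
              RAM.Holds s' 1 T ∧ DimRedHamCenter c p (ε / 5) ω T) ∧
          -- with high probability its output is a `(2 + ε)`-approximate set of `ℓ` centers
          1 - (n : ℝ) ^ (-α) ≤ fairCoins.real {ω | ∀ T : Fin ℓ → Fin n,
            DimRedHamCenter c p (ε / 5) ω T →
              (centerCost p (fun i => p (T i)) : ℝ) ≤ (2 + ε) * optCenterCost p ℓ} ∧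
          -- the same for the modification and minimum-diameter clustering
          (∀ (ω : ℕ → Bool) (s : RAM.State), RAM.Encodes p ℓ (ε / 5) ω s →
            ∃ (s' : RAM.State) (a : Fin n → Fin ℓ),
              RAM.HaltsWithin progCluster s
                (C * (n * Real.log n * ((d : ℝ) + ℓ) / ε ^ 2)) s' ∧
              RAM.Holds s' 2 a ∧ DimRedHamCluster c p (ε / 5) ω a) ∧
          1 - (n : ℝ) ^ (-α) ≤ fairCoins.real {ω | ∀ a : Fin n → Fin ℓ,
            DimRedHamCluster c p (ε / 5) ω a →
              (clusterDiam p a : ℝ) ≤ (2 + ε) * optClusterDiam p ℓ} := by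
  -- The value `16 * (α + 3)` comes from `mul_sq_exp_le_rpow`, and `15600 = 200 * 78` from `time_le`
  -- and `projDim_le`. Both procedures use the same program and differ only in the array that is
  -- read.
  refine ⟨⌈16 * (α + 3)⌉₊, fun c hc => ⟨RAM.clusterCmd c, RAM.clusterCmd c, 15600 * c,
    fun n d ℓ p ε hℓ hℓn hε hε1 => ?_⟩⟩
  have hc' : 16 * (α + 3) ≤ c := Nat.ceil_le.1 hc
  have hc1 : 1 ≤ c := by
    have : (1 : ℝ) ≤ c := by linarith
    exact_mod_cast this
  have hn : 2 ≤ n := by omega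
  have hk := projDim_pos (by positivity : 0 < ε / 5) hn hc1
  refine ⟨fun ω s hs => ?_, one_sub_rpow_le_of_near p hn hc' hε hε1 fun ω hω T hT =>
    hω.centerCost_le hT hℓ hk hε hε1, fun ω s hs => ?_,
    one_sub_rpow_le_of_near p hn hc' hε hε1 ?_⟩
  · obtain ⟨s', T, a, hh, h1, h2, hT, ha⟩ :=
      RAM.exists_haltsWithin_clusterCmd hs hc1 hε hε1 hℓ hℓn
    exact ⟨s', T, hh, h1, hT⟩
  · obtain ⟨s', T, a, hh, h1, h2, hT, ha⟩ :=
      RAM.exists_haltsWithin_clusterCmd hs hc1 hε hε1 hℓ hℓn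
    exact ⟨s', a, hh, h2, ha⟩
  · rintro ω hω a ⟨T, hT, -, ha⟩
    exact hω.clusterDiam_le hT hℓ hk hε hε1 ha
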